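/- For points $P,Q,R$ of the Euclidean plane let $[P,Q,R]=(x_Q-x_P)(y_R-y_P)-(y_Q-y_P)(x_R-x_P)$; it is positive if and only if $R$ lies strictly to the left of the directed line $PQ$. A \emph{Harborth configuration} (a quarter of the Harborth graph, in coordinates centered at $A$) consists of points $A=(0,0)$, $B=(t,T)$, $C=(2t,0)$ and $D,E,F,G,H,J$ of $\mathbb R^2$, $P=(x_P,y_P)$, with $t>0$, $T\ge 0$, such that \begin{gather*} t^2+T^2=1,\\ -t(x_D-2t)+T\,y_D=\tfrac32,\qquad |CD|=3,\\ t(x_E-t)-T(y_E-T)=-1,\qquad |BE|=2,\\ |AF|=|EF|=1,\quad |FG|=1,\ |DG|=2,\quad |DH|=|GH|=2,\quad |FJ|=|GJ|=1,\\ x_H=x_J, \end{gather*} where the points are chosen as in the Harborth graph: $[B,C,D]>0$, $[B,C,E]>0$, $[A,E,F]>0$, $[F,D,G]>0$, $[D,G,H]<0$, $[F,G,J]>0$. (So $BCDE$ is a symmetric trapezoid with parallel sides $|CD|=3$, $|BE|=2$ over the side $BC$ of the isosceles triangle $ABC$ of height $T$, and the line $HJ$ is perpendicular to $AC$.) The \emph{minimal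 polynomial} of a real number $\alpha$ is the primitive polynomial with integer coefficients and positive leading coefficient which vanishes at $\alpha$ and has the smallest degree among all nonzero integer polynomials that vanish at $\alpha$. \textbf{Theorem.} A Harborth configuration exists, and in every Harborth configuration the minimal polynomials of the $y$-coordinates $y_D$, $y_E$, $y_F$ are, respectively, \begin{align*} P_{y_D}={}&-2470693585135788+1679453964496051893\,y^2-2462573171102886288\,y^4+1847147913929328048\,y^6\\ &-888334179987132288\,y^8+302241307009227264\,y^{10}-74768143621533696\,y^{12}+13516084620361728\,y^{14}\\ &-1721332250836992\,y^{16}+139442448236544\,y^{18}-6126808596480\,y^{20}+109337116672\,y^{22},\\ P_{y_E}={}&-387038865725307+255845547796716\,y^2-1080696123714384\,y^4+985178573370432\,y^6\\ &+290816529555456\,y^8+1229422640467968\,y^{10}-399291497201664\,y^{12}-226953868935168\,y^{14}\\ &-145914316455936\,y^{16}+84049703993344\,y^{18}-9462031056896\,y^{20}+437348466688\,y^{22},\\ P_{y_F}={}&-6156736033068+4132620043369020\,y^2-28069535202466347\,y^4+54174190167055116\,y^6\\ &-44321252355544320\,y^8+16893977313239424\,y^{10}-3430375146685440\,y^{12}+781964817629184\,y^{14}\\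 &-165954075623424\,y^{16}+16400930701312\,y^{18}-579898179584\,y^{20}+27334279168\,y^{22}. \end{align*} Each of them is even, of degree $22$ and irreducible over $\mathbb Z$. Moreover, let \begin{align*} P_T={}&-492075+52356780\,T^2-1441635408\,T^4+12222052416\,T^6-60567699456\,T^8+189747007488\,T^{10}\\ &-417660420096\,T^{12}+607025037312\,T^{14}-655053815808\,T^{16}+446118756352\,T^{18}-422064422912\,T^{20}+437348466688\,T^{22},\\ P_{y_D,T}={}&27-36T^2+12T\,y-4y^2,\qquad P_{y_E,T}=-3+7T^2-4T\,y+y^2,\\ P_{y_F,T}={}&81-648T^2+144T^4-2304T^6+4096T^8+(432T-864T^3+6528T^5-10240T^7)\,y\\ &+(-216+1584T^2-5376T^4+9216T^6)\,y^2+(-576T+1536T^3-4096T^5)\,y^3+(144-384T^2+1024T^4)\,y^4, \end{align*} and for $P\in\{D,E,F\}$ let $R_P\in\mathbb Z[y]$ be the resultant of $P_{y_P,T}$ and $P_T$ with respect to $T$. Then $R_D$, $R_E$, $R_F$ have degrees $44$, $44$, $88$, and $P_{y_P}$ divides $R_P$ in $\mathbb Z[y]$ for each $P\in\{D,E,F\}$.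 -/

import Mathlib

open Polynomial

namespace Harborth

/-- Twice the signed area of the triangle `(x₁, y₁), (x₂, y₂), (x₃, y₃)`: it is positive when the
third point lies strictly to the left of the directed line from the first to the second point,
and negative when it lies strictly to the right. -/
def orient (x₁ y₁ x₂ y₂ x₃ y₃ : ℝ) : ℝ :=
  (x₂ - x₁) * (y₃ - y₁) - (y₂ - y₁) * (x₃ - x₁)

/-- The Harborth configuration (a quarter of the Harborth graph), in coordinates with `A = (0, 0)`,
`B = (t, T)` and `C = (2 t, 0)`, where `T` is such that the lines `AC` and `HJ` are perpendicular.
The equations are the metric constraints; the sign conditions fix the choice of each point among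
the (at most) two candidates that the equations leave. -/
structure Configuration where
  (t T xD yD xE yE xF yF xG yG xH yH xJ yJ : ℝ)
  /-- `C` lies on the positive `x`-axis. -/
  t_pos : 0 < t
  /-- `T` is a height. -/
  T_nonneg : 0 ≤ T
  /-- `|AB| = 1` (and so `|BC| = 1`). -/
  dist_AB : t ^ 2 + T ^ 2 - 1 = 0
  /-- The angle `BCD` is `60°`. -/
  angle_D : -t * (xD - 2 * t) + T * yD - 3 / 2 = 0
  /-- `|CD| = 3`. -/
  dist_CD : (xD - 2 * t) ^ 2 + yD ^ 2 - 9 = 0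
  /-- The angle `CBE` is `120°`. -/
  angle_E : t * (xE - t) - T * (yE - T) + 1 = 0
  /-- `|BE| = 2`. -/
  dist_BE : (xE - t) ^ 2 + (yE - T) ^ 2 - 4 = 0
  /-- `F` lies on the unit circle around `A` ... -/
  dist_AF : xF ^ 2 + yF ^ 2 - 1 = 0
  /-- ... and on the unit circle around `E`. -/
  dist_EF : (xE - xF) ^ 2 + (yE - yF) ^ 2 - 1 = 0
  /-- `|FG| = 1`. -/
  dist_FG : (xF - xG) ^ 2 + (yF - yG) ^ 2 - 1 = 0
  /-- `|DG| = 2`. -/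
  dist_DG : (xD - xG) ^ 2 + (yD - yG) ^ 2 - 4 = 0
  /-- `|DH| = 2`. -/
  dist_DH : (xD - xH) ^ 2 + (yD - yH) ^ 2 - 4 = 0
  /-- `|GH| = 2`. -/
  dist_GH : (xG - xH) ^ 2 + (yG - yH) ^ 2 - 4 = 0
  /-- `|FJ| = 1`. -/
  dist_FJ : (xF - xJ) ^ 2 + (yF - yJ) ^ 2 - 1 = 0
  /-- `|GJ| = 1`. -/
  dist_GJ : (xG - xJ) ^ 2 + (yG - yJ) ^ 2 - 1 = 0
  /-- `HJ` is perpendicular to `AC`. -/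
  ortho : xH - xJ = 0
  /-- The trapezoid `BCDE` lies above the line `BC` (on the side that does not contain `A`). -/
  side_D : 0 < orient t T (2 * t) 0 xD yD
  /-- The same for `E`. -/
  side_E : 0 < orient t T (2 * t) 0 xE yE
  /-- `F` lies to the left of `AE`, so that the quadrangle `ABEF` is convex. -/
  side_F : 0 < orient 0 0 xE yE xF yF
  /-- `G` lies to the left of `FD` (`E` lies to the right). -/
  side_G : 0 < orient xF yF xD yD xG yG
  /-- `H` lies to the right of `DG` (`F` lies to the left). -/
  side_H : orient xD yD xG yG xH yH < 0
  /-- `J` lies to the left of `FG` (`D` lies to the right). -/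
  side_J : 0 < orient xF yF xG yG xJ yJ

/-- `P` is the minimal polynomial of the real number `α` over the integers: the primitive integer
polynomial of smallest degree that vanishes at `α`, its sign being normalized by the leading
coefficient. -/
structure IsMinimalPolynomial (P : ℤ[X]) (α : ℝ) : Prop where
  primitive : P.IsPrimitive
  leadingCoeff_pos : 0 < P.leadingCoeff
  root : aeval α P = 0
  minimal : ∀ Q : ℤ[X], Q ≠ 0 → aeval α Q = 0 → P.natDegree ≤ Q.natDegree

/-- The polynomial `P_T`. -/
noncomputable def PT : ℤ[X] :=
  -492075 + 52356780 * X ^ 2 - 1441635408 * X ^ 4 + 12222052416 * X ^ 6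
    - 60567699456 * X ^ 8 + 189747007488 * X ^ 10 - 417660420096 * X ^ 12
    + 607025037312 * X ^ 14 - 655053815808 * X ^ 16 + 446118756352 * X ^ 18
    - 422064422912 * X ^ 20 + 437348466688 * X ^ 22

/-- The polynomial `P_{y_D}`. -/
noncomputable def PyD : ℤ[X] :=
  -2470693585135788 + 1679453964496051893 * X ^ 2 - 2462573171102886288 * X ^ 4
    + 1847147913929328048 * X ^ 6 - 888334179987132288 * X ^ 8
    + 302241307009227264 * X ^ 10 - 74768143621533696 * X ^ 12
    + 13516084620361728 * X ^ 14 - 1721332250836992 * X ^ 16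
    + 139442448236544 * X ^ 18 - 6126808596480 * X ^ 20 + 109337116672 * X ^ 22

/-- The polynomial `P_{y_E}`. -/
noncomputable def PyE : ℤ[X] :=
  -387038865725307 + 255845547796716 * X ^ 2 - 1080696123714384 * X ^ 4
    + 985178573370432 * X ^ 6 + 290816529555456 * X ^ 8 + 1229422640467968 * X ^ 10
    - 399291497201664 * X ^ 12 - 226953868935168 * X ^ 14 - 145914316455936 * X ^ 16
    + 84049703993344 * X ^ 18 - 9462031056896 * X ^ 20 + 437348466688 * X ^ 22

/-- The polynomial `P_{y_F}`. -/
noncomputable def PyF : ℤ[X] :=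
  -6156736033068 + 4132620043369020 * X ^ 2 - 28069535202466347 * X ^ 4
    + 54174190167055116 * X ^ 6 - 44321252355544320 * X ^ 8 + 16893977313239424 * X ^ 10
    - 3430375146685440 * X ^ 12 + 781964817629184 * X ^ 14 - 165954075623424 * X ^ 16
    + 16400930701312 * X ^ 18 - 579898179584 * X ^ 20 + 27334279168 * X ^ 22

/-! Bivariate polynomials in `T` and `y` are elements of `ℤ[X][X]`: the outer variable `X` is `T`
and the coefficients are polynomials in `y = C X`. -/

/-- The polynomial `P_{y_D, T}`. -/
noncomputable def PyDT : ℤ[X][X] :=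
  27 - 36 * X ^ 2 + 12 * X * C X - 4 * (C X) ^ 2

/-- The polynomial `P_{y_E, T}`. -/
noncomputable def PyET : ℤ[X][X] :=
  -3 + 7 * X ^ 2 - 4 * X * C X + (C X) ^ 2

/-- The polynomial `P_{y_F, T}`. -/
noncomputable def PyFT : ℤ[X][X] :=
  81 - 648 * X ^ 2 + 144 * X ^ 4 - 2304 * X ^ 6 + 4096 * X ^ 8
    + (432 * X - 864 * X ^ 3 + 6528 * X ^ 5 - 10240 * X ^ 7) * C X
    + (-216 + 1584 * X ^ 2 - 5376 * X ^ 4 + 9216 * X ^ 6) * (C X) ^ 2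
    + (-576 * X + 1536 * X ^ 3 - 4096 * X ^ 5) * (C X) ^ 3
    + (144 - 384 * X ^ 2 + 1024 * X ^ 4) * (C X) ^ 4

/-- The resultant of `P(T, y)` and `P_T(T)` with respect to `T`, a polynomial in `y`. -/
noncomputable def resultantPT (P : ℤ[X][X]) : ℤ[X] :=
  resultant P (PT.map C)

/-- A polynomial is even if it only contains monomials of even degree. -/
def IsEven (P : ℤ[X]) : Prop :=
  ∀ n ∈ P.support, Even n

end Harborth

/-!
The idea is to describe all configurations by one real parameter of degree `11` over `ℚ`.

Put `s = √3 t` and `r = T / s`. Because of the angles of `60°` and `120°`, every point has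
coordinates `(t x, s y)` with `x` and `y` in the field `ℚ(r, k)`, where `k` describes the isosceles
triangle `AEF` and satisfies the curve equation `k² (7r² + 4r + 1) = 1 - 12r - 9r²`. The condition
`x_H = x_J` is linear in the height of `G`, since `H` and `J` arise from `G` by rotations by `60°`
around `D` and `F`. So `G` can be eliminated, and one equation `closing r k = 0` remains
(`Configuration.exists_parameters`). Its norm over `ℚ(r)` is `slopePoly`, of degree `11`, up to
factors without roots `r ≥ 0` (`IsParameter.aeval_slopePoly_eq_zero`), and it makes `k` a rational
function of `r` (`IsParameter.k_eq`). Conversely, `closing` changes sign along the curve, and a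
zero yields a configuration (`exists_isParameter`, `IsParameter.nonempty_configuration`).

Since `s² = 3 / (1 + 3r²)`, the squares of `T`, `y_D`, `y_E`, `y_F` lie in `ℚ(r)`. Writing such a
square as a fraction `N / M` in `r`, the vanishing of the given polynomials is the divisibility of a
homogenization in `(N, M)` by `slopePoly`.

`slopePoly` is irreducible modulo `17` by Rabin's test (`pow_frobenius_eq_self`), so `ℚ(r)` has prime
degree `11`. The squares `y_P²` are irrational, as their polynomials have no roots modulo `11`; hence
they have degree `11`. The numbers `y_P` themselves have degree `22`, as otherwise `y_P ∈ ℚ(r)` and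
the norm of `y_P²` would be the square of a rational number (`natDegree_minpoly_of_sq`). So the given
primitive polynomials of degree `22` are the minimal polynomials, and they are irreducible.

Over `ℂ`, the resultant is, up to a constant factor, the product of the polynomials `P(τ, y)` over
the `22` roots `τ` of `P_T`, which gives its degree (`natDegree_resultantPT`). It vanishes at `y_P`,
because `T` is a common root, and so it is divisible by the minimal polynomial of `y_P`.
-/

namespace Harborth

/-! ### Parametrization of the configurations -/

/-- The polynomial of degree `11` satisfied by the slope parameter `r = T / (√3 t)`. -/
noncomputable def slopePoly : ℤ[X] :=
  -5 - 35 * X + 593 * X ^ 2 + 8375 * X ^ 3 + 50574 * X ^ 4 + 192738 * X ^ 5 + 541986 * X ^ 6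
    + 1225454 * X ^ 7 + 2267879 * X ^ 8 + 3157585 * X ^ 9 + 2836509 * X ^ 10 + 1105227 * X ^ 11

/-- The closing condition `x_H = x_J` in the parameters `r` and `k`, after the reduction modulo the
curve equation to an expression of degree one in `k`. -/
def closing (r k : ℝ) : ℝ :=
  11 - 10 * r - 295 * r ^ 2 - 1308 * r ^ 3 - 2379 * r ^ 4 - 4698 * r ^ 5 - 3321 * r ^ 6
    - (16 + 138 * r + 474 * r ^ 2 + 956 * r ^ 3 + 1380 * r ^ 4 + 1914 * r ^ 5 + 1170 * r ^ 6) * k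

/-- Parameters of a configuration: `s = √3 t`, `r = T / s`, and `k = √3 · tan θ`, where `θ` is the
angle at the base `AE` of the isosceles triangle `AEF`, so that `F = E / 2 + k / (2 √3) · E⊥`. Then
`scale` is `|AB| = 1`, `curve` is `|AF| = 1`, and `closing` is `x_H = x_J`. -/
structure IsParameter (r k s : ℝ) : Prop where
  r_nonneg : 0 ≤ r
  k_pos : 0 < k
  s_pos : 0 < s
  curve : k ^ 2 * (7 * r ^ 2 + 4 * r + 1) = 1 - 12 * r - 9 * r ^ 2
  scale : s ^ 2 * (1 + 3 * r ^ 2) = 3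
  closing : closing r k = 0

/-- The third vertex of an equilateral triangle is obtained by a rotation by `60°`. -/
lemma eq_rotation_of_equilateral {q a b u v n : ℝ} (hq : 0 ≤ q) (hq3 : q ^ 2 = 3) (hn : 0 < n)
    (h₁ : a ^ 2 + b ^ 2 = n) (h₂ : u ^ 2 + v ^ 2 = n) (h₃ : (a - u) ^ 2 + (b - v) ^ 2 = n)
    (hpos : 0 < a * v - b * u) :
    u = a / 2 - q / 2 * b ∧ v = q / 2 * a + b / 2 := by
  have hdot : a * u + b * v = n / 2 := by linear_combination (h₁ + h₂ - h₃) / 2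
  have hcross : a * v - b * u = q / 2 * n := by
    refine (sq_eq_sq₀ hpos.le (by positivity)).mp ?_
    linear_combination (u ^ 2 + v ^ 2) * h₁ + n * h₂ - (a * u + b * v + n / 2) * hdot
      - n ^ 2 / 4 * hq3
  constructor
  · refine mul_left_cancel₀ hn.ne' ?_
    linear_combination a * hdot - b * hcross - u * h₁
  · refine mul_left_cancel₀ hn.ne' ?_
    linear_combination b * hdot + a * hcross - v * h₁

set_option maxHeartbeats 1000000 in
/-- The heights in every configuration are expressed by parameters `r`, `k`, `s`. Rotations by `60°`
place `D` and `E`, and turn `x_H = x_J` into a linear equation for the height of `G`. The circles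
around `F` and `D` through `G` then give two equations for the abscissa of `G`, and eliminating it
leaves the closing condition. -/
theorem Configuration.exists_parameters (c : Configuration) :
    ∃ r k s : ℝ, IsParameter r k s ∧ c.T = s * r ∧ c.yD = s * (3 / 2 * (r + 1)) ∧
      c.yE = s * (2 * r + 1) ∧ c.yF = s * ((2 * r + 1 + k * r) / 2) := by
  obtain ⟨t, T, xD, yD, xE, yE, xF, yF, xG, yG, xH, yH, xJ, yJ, ht, hT, hAB, aD, dCD, aE, dBE,
    dAF, dEF, dFG, dDG, dDH, dGH, dFJ, dGJ, ort, sD, sE, sF, sG, sH, sJ⟩ := c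
  simp only [orient] at sD sE sF sG sH sJ
  dsimp only
  obtain ⟨q, hq, hq3⟩ : ∃ q : ℝ, 0 < q ∧ q ^ 2 = 3 := ⟨√3, by positivity, by norm_num⟩
  -- the components of `CD` and `BE` perpendicular to `BC` are known up to a sign, which the
  -- orientation conditions fix
  have hDs : t * yD + T * (xD - 2 * t) = 3 * q / 2 := by
    refine (sq_eq_sq₀ (by linarith) (by positivity)).mp ?_
    linear_combination (t ^ 2 + T ^ 2) * dCD + 9 * hAB
      - (-t * (xD - 2 * t) + T * yD + 3 / 2) * aD - 9 / 4 * hq3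
  have hyD : yD = 3 / 2 * (T + q * t) := by
    linear_combination t * hDs + T * aD - yD * hAB
  have hxD : xD = 2 * t + 3 / 2 * (q * T - t) := by
    linear_combination T * hDs - t * aD - (xD - 2 * t) * hAB
  have hEs : t * (yE - T) + T * (xE - t) = q := by
    refine (sq_eq_sq₀ (by linarith) hq.le).mp ?_
    linear_combination (t ^ 2 + T ^ 2) * dBE + 4 * hAB
      - (t * (xE - t) - T * (yE - T) - 1) * aE - hq3
  have hyE : yE = 2 * T + q * t := by
    linear_combination t * hEs - T * aE - (yE - T) * hAB
  have hxE : xE = q * T := by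
    linear_combination T * hEs + t * aE - (xE - t) * hAB
  -- `DGH` and `FGJ` are equilateral; the first is oriented clockwise, so it is reflected
  obtain ⟨hxH, -⟩ := eq_rotation_of_equilateral (a := xG - xD) (b := -(yG - yD)) (u := xH - xD)
    (v := -(yH - yD)) (n := 4) hq.le hq3 (by norm_num) (by linear_combination dDG)
    (by linear_combination dDH) (by linear_combination dGH) (by linarith)
  obtain ⟨hxJ, -⟩ := eq_rotation_of_equilateral (a := xG - xF) (b := yG - yF) (u := xJ - xF)
    (v := yJ - yF) (n := 1) hq.le hq3 (by norm_num) (by linear_combination dFG)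
    (by linear_combination dFJ) (by linear_combination dGJ) (by linarith)
  obtain ⟨r, hr⟩ : ∃ r, T = q * t * r := ⟨T / (q * t), by field_simp⟩
  have hr0 : 0 ≤ r := by
    by_contra! h
    have : q * t * r < 0 := mul_neg_of_pos_of_neg (by positivity) h
    linarith
  have hK : 0 < 7 * r ^ 2 + 4 * r + 1 := by positivity
  have hsc : t ^ 2 * (1 + 3 * r ^ 2) = 1 := by
    rw [hr] at hAB
    linear_combination hAB - t ^ 2 * r ^ 2 * hq3
  have hxE' : xE = 3 * t * r := by rw [hxE, hr]; linear_combination t * r * hq3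
  have hyE' : yE = q * t * (2 * r + 1) := by rw [hyE, hr]; ring
  have hE2 : xE ^ 2 + yE ^ 2 = 3 * t ^ 2 * (7 * r ^ 2 + 4 * r + 1) := by
    rw [hxE', hyE']; linear_combination t ^ 2 * (2 * r + 1) ^ 2 * hq3
  -- `cr` is twice the area of `AEF` and `N = |AE| ^ 2`
  set cr := xE * yF - yE * xF with hcr
  have hcr0 : 0 < cr := by rw [hcr]; linarith
  set N := 3 * t ^ 2 * (7 * r ^ 2 + 4 * r + 1) with hN
  have hN0 : 0 < N := by positivity
  have hdot : xE * xF + yE * yF = N / 2 := by linear_combination (dAF - dEF + hE2) / 2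
  have hcr2 : cr ^ 2 = N - N ^ 2 / 4 := by
    linear_combination (xE ^ 2 + yE ^ 2) * dAF + hE2 - (xE * xF + yE * yF + N / 2) * hdot
  obtain ⟨k, hk⟩ : ∃ k, N * k = 2 * q * cr := ⟨2 * q * cr / N, by field_simp⟩
  have hk0 : 0 < k := by
    have : 0 < N * k := by rw [hk]; positivity
    exact (pos_iff_pos_of_mul_pos this).mp hN0
  have hxF : xF = t * ((3 * r - k * (2 * r + 1)) / 2) := by
    refine mul_left_cancel₀ hN0.ne' ?_
    linear_combination xE * hdot - yE * hcr - xF * hE2 + N / 2 * hxE' - cr * hyE'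
      + t * (2 * r + 1) / 2 * hk
  have hyF : yF = q * t * ((2 * r + 1 + k * r) / 2) := by
    refine mul_left_cancel₀ hN0.ne' ?_
    linear_combination yE * hdot + xE * hcr - yF * hE2 + N / 2 * hyE' + cr * hxE'
      - q * t * r / 2 * hk - t * r * cr * hq3
  have hcurve : k ^ 2 * (7 * r ^ 2 + 4 * r + 1) = 1 - 12 * r - 9 * r ^ 2 := by
    have h1 : N * k ^ 2 = 12 - 3 * N := by
      refine mul_left_cancel₀ hN0.ne' ?_
      linear_combination (N * k + 2 * q * cr) * hk + 4 * cr ^ 2 * hq3 + 12 * hcr2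
    refine mul_left_cancel₀ (by positivity : 3 * t ^ 2 ≠ 0) ?_
    rw [hN] at h1
    linear_combination h1 - 12 * hsc
  have hxD' : xD = t * ((1 + 9 * r) / 2) := by
    rw [hxD, hr]; linear_combination 3 / 2 * t * r * hq3
  have hyD' : yD = q * t * (3 / 2 * (r + 1)) := by rw [hyD, hr]; ring
  -- the condition `x_H = x_J` determines the height of `G`
  have hyG : yG = q * t * ((9 * r + 11 + k * r - k) / 12) := by
    have h : xD - xF + q * (2 * yG - yD - yF) = 0 := by
      linear_combination 2 * ort - 2 * hxH + 2 * hxJ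
    rw [hxD', hxF, hyD', hyF] at h
    refine mul_left_cancel₀ (mul_pos two_pos hq).ne' ?_
    linear_combination h + t * (3 / 2 * (r + 1) + (2 * r + 1 + k * r) / 2
      - (9 * r + 11 + k * r - k) / 6) * hq3
  obtain ⟨p, hp⟩ : ∃ p, xG = t * p := ⟨xG / t, by field_simp⟩
  have ht2 : t ^ 2 ≠ 0 := by positivity
  have hFG : (p - (3 * r - k * (2 * r + 1)) / 2) ^ 2 + 3 * ((9 * r + 11 + k * r - k) / 12
      - (2 * r + 1 + k * r) / 2) ^ 2 = 1 + 3 * r ^ 2 := by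
    rw [hxF, hyF, hyG, hp] at dFG
    refine mul_left_cancel₀ ht2 ?_
    linear_combination dFG - hsc - t ^ 2 * ((9 * r + 11 + k * r - k) / 12
      - (2 * r + 1 + k * r) / 2) ^ 2 * hq3
  have hDG : (p - (1 + 9 * r) / 2) ^ 2 + 3 * ((9 * r + 11 + k * r - k) / 12
      - 3 / 2 * (r + 1)) ^ 2 = 4 * (1 + 3 * r ^ 2) := by
    rw [hxD', hyD', hyG, hp] at dDG
    refine mul_left_cancel₀ ht2 ?_
    linear_combination dDG - 4 * hsc - t ^ 2 * ((9 * r + 11 + k * r - k) / 12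
      - 3 / 2 * (r + 1)) ^ 2 * hq3
  refine ⟨r, k, q * t, ⟨hr0, hk0, by positivity, hcurve, ?_, ?_⟩, hr, hyD', hyE', hyF⟩
  · linear_combination t ^ 2 * (1 + 3 * r ^ 2) * hq3 + 3 * hsc
  · -- eliminate `p` from the two circle equations
    set d := (1 + k) / 2 + 3 * r + r * k with hd
    set m := (-9 + 4 * k + k ^ 2 + 25 * r + 20 * r * k + 3 * r * k ^ 2 + 6 * r ^ 2
      + 20 * r ^ 2 * k + 2 * r ^ 2 * k ^ 2) / 4 with hm
    have hlin : 2 * d * (p - (3 * r - k * (2 * r + 1)) / 2) = m := by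
      rw [hd, hm]; linear_combination hFG - hDG
    have he : m ^ 2 + 4 * d ^ 2 * (3 * ((9 * r + 11 + k * r - k) / 12
        - (2 * r + 1 + k * r) / 2) ^ 2 - (1 + 3 * r ^ 2)) = 0 := by
      linear_combination 4 * d ^ 2 * hFG
        - (m + 2 * d * (p - (3 * r - k * (2 * r + 1)) / 2)) * hlin
    rw [hd, hm] at he
    unfold Harborth.closing
    linear_combination 3 * (7 * r ^ 2 + 4 * r + 1) * he - 3 * (-11 / 12 + 1 / 3 * k
      + 1 / 12 * k ^ 2 + 11 / 6 * r + 3 * r * k + 2 / 3 * r * k ^ 2 + 199 / 12 * r ^ 2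
      + 12 * r ^ 2 * k + 9 / 4 * r ^ 2 * k ^ 2 + 79 / 2 * r ^ 3 + 74 / 3 * r ^ 3 * k
      + 11 / 3 * r ^ 3 * k ^ 2 + 46 * r ^ 4 + 20 * r ^ 4 * k + 7 / 3 * r ^ 4 * k ^ 2) * hcurve

lemma aeval_slopePoly (r : ℝ) : aeval r slopePoly =
    -5 - 35 * r + 593 * r ^ 2 + 8375 * r ^ 3 + 50574 * r ^ 4 + 192738 * r ^ 5 + 541986 * r ^ 6
      + 1225454 * r ^ 7 + 2267879 * r ^ 8 + 3157585 * r ^ 9 + 2836509 * r ^ 10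
      + 1105227 * r ^ 11 := by
  simp only [slopePoly, map_add, map_sub, map_mul, map_neg, map_pow, map_ofNat, aeval_X]

namespace IsParameter

variable {r k s : ℝ}

/-- Eliminating `k` from the closing condition by taking its norm over `ℝ(r)`; the extraneous factor
`(1 + r) (1 + 3 r²)` has no root `r ≥ 0`. -/
theorem aeval_slopePoly_eq_zero (h : IsParameter r k s) : aeval r slopePoly = 0 := by
  have hr := h.r_nonneg
  have hc := h.closing
  rw [aeval_slopePoly]
  refine (mul_eq_zero.mp ?_).resolve_right
    (by positivity : (1 + r) * (1 + 3 * r ^ 2) ≠ 0)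
  unfold Harborth.closing at hc
  -- `closing r k = a - b k`, and `K a ^ 2 - L b ^ 2` is the norm, with the curve `K k ^ 2 = L`
  set b := 16 + 138 * r + 474 * r ^ 2 + 956 * r ^ 3 + 1380 * r ^ 4 + 1914 * r ^ 5 + 1170 * r ^ 6
    with hb
  linear_combination ((7 * r ^ 2 + 4 * r + 1) * (11 - 10 * r - 295 * r ^ 2 - 1308 * r ^ 3
    - 2379 * r ^ 4 - 4698 * r ^ 5 - 3321 * r ^ 6 + b * k) * hc + b ^ 2 * h.curve
    + (1 - 12 * r - 9 * r ^ 2) * (b + (16 + 138 * r + 474 * r ^ 2 + 956 * r ^ 3 + 1380 * r ^ 4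
    + 1914 * r ^ 5 + 1170 * r ^ 6)) * hb) / 27

/-- The parameter `k` is a rational function of `r`. Modulo `slopePoly` it is `a / b`, where
`closing r k = a - b k`; the fraction is written with numerator and denominator of degree `5`. -/
theorem k_eq (h : IsParameter r k s) :
    k * (59 + 453 * r + 1038 * r ^ 2 - 782 * r ^ 3 - 6825 * r ^ 4 - 8919 * r ^ 5) =
      49 - 89 * r - 2342 * r ^ 2 - 8586 * r ^ 3 - 9963 * r ^ 4 - 189 * r ^ 5 := by
  have hr := h.r_nonneg
  have hc := h.closing
  have hs := h.aeval_slopePoly_eq_zero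
  rw [aeval_slopePoly] at hs
  unfold Harborth.closing at hc
  refine mul_left_cancel₀ (by positivity : 16 + 138 * r + 474 * r ^ 2 + 956 * r ^ 3
    + 1380 * r ^ 4 + 1914 * r ^ 5 + 1170 * r ^ 6 ≠ 0) ?_
  linear_combination 27 * hs - (59 + 453 * r + 1038 * r ^ 2 - 782 * r ^ 3 - 6825 * r ^ 4
    - 8919 * r ^ 5) * hc

end IsParameter

/-- Parameters satisfying the closing condition exist by the intermediate value theorem: along the
branch `k > 0` of the curve, the closing expression changes sign between `r = 0` and `r = 1/13`. -/
theorem exists_isParameter : ∃ r k s : ℝ, IsParameter r k s ∧ r ≤ 1 / 13 ∧ k ≤ 1 := by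
  let κ : ℝ → ℝ := fun r => √((1 - 12 * r - 9 * r ^ 2) / (7 * r ^ 2 + 4 * r + 1))
  have hK : ∀ r : ℝ, 0 < 7 * r ^ 2 + 4 * r + 1 := fun r => by nlinarith [sq_nonneg (7 * r + 2)]
  have hκ : Continuous κ :=
    Real.continuous_sqrt.comp (Continuous.div (by fun_prop) (by fun_prop) fun r => (hK r).ne')
  have hcont : Continuous fun r => closing r (κ r) := by unfold closing; fun_prop
  have h0 : closing 0 (κ 0) ≤ 0 := by simp [closing, κ]; norm_num
  have h1 : 0 ≤ closing (1 / 13) (κ (1 / 13)) := by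
    have : κ (1 / 13) ≤ 1 / 7 := by
      rw [Real.sqrt_le_left (by norm_num)]; norm_num
    unfold closing
    nlinarith
  obtain ⟨r, ⟨hr0, hr1⟩, hr⟩ := intermediate_value_Icc (by norm_num : (0 : ℝ) ≤ 1 / 13)
    hcont.continuousOn ⟨h0, h1⟩
  have hL : 0 < 1 - 12 * r - 9 * r ^ 2 := by nlinarith
  refine ⟨r, κ r, √(3 / (1 + 3 * r ^ 2)), ⟨hr0, ?_, by positivity, ?_, ?_, hr⟩, hr1, ?_⟩
  · exact Real.sqrt_pos.mpr (div_pos hL (hK r))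
  · rw [Real.sq_sqrt (div_pos hL (hK r)).le, div_mul_cancel₀ _ (hK r).ne']
  · rw [Real.sq_sqrt (by positivity), div_mul_cancel₀ _ (by positivity)]
  · rw [Real.sqrt_le_left (by norm_num), div_le_iff₀ (hK r)]
    nlinarith

set_option maxHeartbeats 1000000 in
/-- From parameters with `r ≤ 1/13` and `k ≤ 1` the configuration is rebuilt. The bounds are needed
only for the orientation of the triangle `FDG`. -/
theorem IsParameter.nonempty_configuration {r k s : ℝ} (h : IsParameter r k s)
    (hr1 : r ≤ 1 / 13) (hk1 : k ≤ 1) : Nonempty Configuration := by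
  obtain ⟨hr, hk, hs, hcurve, hscale, hclosing⟩ := h
  obtain ⟨q, hq, hq3⟩ : ∃ q : ℝ, 0 < q ∧ q ^ 2 = 3 := ⟨√3, by positivity, by norm_num⟩
  obtain ⟨t, ht⟩ : ∃ t, s = q * t := ⟨s / q, by field_simp⟩
  have ht0 : 0 < t := (pos_iff_pos_of_mul_pos (ht ▸ hs)).mp hq
  have hsc : t ^ 2 * (1 + 3 * r ^ 2) = 1 := by
    rw [ht] at hscale
    linear_combination hscale / 3 - t ^ 2 * (1 + 3 * r ^ 2) / 3 * hq3
  obtain ⟨d, hd⟩ : ∃ d, d = (1 + k) / 2 + 3 * r + r * k := ⟨_, rfl⟩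
  have hd0 : 0 < d := by rw [hd]; positivity
  obtain ⟨m, hm⟩ : ∃ m, m = (-9 + 4 * k + k ^ 2 + 25 * r + 20 * r * k + 3 * r * k ^ 2
    + 6 * r ^ 2 + 20 * r ^ 2 * k + 2 * r ^ 2 * k ^ 2) / 4 := ⟨_, rfl⟩
  obtain ⟨e, he⟩ : ∃ e, 2 * d * e = m := ⟨m / (2 * d), by field_simp⟩
  -- the coordinates of `D`, `F`, `G` are `t * x` and `q * t * y` with the following `x` and `y`
  obtain ⟨dx, hdx⟩ : ∃ dx, dx = (1 + 9 * r) / 2 := ⟨_, rfl⟩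
  obtain ⟨dy, hdy⟩ : ∃ dy, dy = 3 / 2 * (r + 1) := ⟨_, rfl⟩
  obtain ⟨fx, hfx⟩ : ∃ fx, fx = (3 * r - k * (2 * r + 1)) / 2 := ⟨_, rfl⟩
  obtain ⟨fy, hfy⟩ : ∃ fy, fy = (2 * r + 1 + k * r) / 2 := ⟨_, rfl⟩
  obtain ⟨gx, hgx⟩ : ∃ gx, gx = fx + e := ⟨_, rfl⟩
  obtain ⟨gy, hgy⟩ : ∃ gy, gy = (9 * r + 11 + k * r - k) / 12 := ⟨_, rfl⟩
  have hFG : (gx - fx) ^ 2 + 3 * (gy - fy) ^ 2 = 1 + 3 * r ^ 2 := by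
    have hK : 0 < 7 * r ^ 2 + 4 * r + 1 := by positivity
    have h1 : m ^ 2 + 4 * d ^ 2 * (3 * (gy - fy) ^ 2 - (1 + 3 * r ^ 2)) = 0 := by
      refine mul_left_cancel₀ hK.ne' ?_
      unfold Harborth.closing at hclosing
      rw [hd, hm, hgy, hfy]
      linear_combination hclosing / 3 + (-11 / 12 + 1 / 3 * k
        + 1 / 12 * k ^ 2 + 11 / 6 * r + 3 * r * k + 2 / 3 * r * k ^ 2 + 199 / 12 * r ^ 2
        + 12 * r ^ 2 * k + 9 / 4 * r ^ 2 * k ^ 2 + 79 / 2 * r ^ 3 + 74 / 3 * r ^ 3 * k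
        + 11 / 3 * r ^ 3 * k ^ 2 + 46 * r ^ 4 + 20 * r ^ 4 * k
        + 7 / 3 * r ^ 4 * k ^ 2) * hcurve
    refine mul_left_cancel₀ (by positivity : 4 * d ^ 2 ≠ 0) ?_
    rw [hgx]
    linear_combination h1 + (2 * d * e + m) * he
  have hDG : (gx - dx) ^ 2 + 3 * (gy - dy) ^ 2 = 4 * (1 + 3 * r ^ 2) := by
    rw [hd, hm] at he
    rw [hfy, hgy] at hFG
    rw [hgx, hfx] at *
    rw [hdx, hdy, hgy]
    linear_combination hFG - he
  have hH : dx - fx + 3 * (2 * gy - dy - fy) = 0 := by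
    rw [hdx, hfx, hgy, hdy, hfy]; ring
  have hEF : t ^ 2 * (fx ^ 2 + 3 * fy ^ 2) = 1 := by
    rw [hfx, hfy]
    linear_combination hsc + t ^ 2 / 4 * hcurve
  have hF : 0 < 3 * r * fy - (2 * r + 1) * fx := by
    rw [hfx, hfy]; ring_nf; positivity
  have hG : 0 < (dx - fx) * (gy - fy) - (dy - fy) * (gx - fx) := by
    have h1 : 0 < 2 * d * ((dx - fx) * (gy - fy)) - (dy - fy) * m := by
      rw [hdx, hfx, hdy, hfy, hgy, hd, hm]
      have : 0 < 59 - 15 * k - 3 * k ^ 2 - k ^ 3 - 66 * r - 102 * r * k - 18 * r * k ^ 2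
          - 6 * r * k ^ 3 + 33 * r ^ 2 - 129 * r ^ 2 * k - 57 * r ^ 2 * k ^ 2
          - 15 * r ^ 2 * k ^ 3 - 126 * r ^ 3 - 294 * r ^ 3 * k - 78 * r ^ 3 * k ^ 2
          - 14 * r ^ 3 * k ^ 3 := by
        have hk2 : k ^ 2 ≤ 1 := pow_le_one₀ hk.le hk1
        have hk3 : k ^ 3 ≤ 1 := pow_le_one₀ hk.le hk1
        have hb : ∀ x y : ℝ, 0 ≤ x → y ≤ 1 → x * y ≤ x := fun x y hx hy =>
          mul_le_of_le_one_right hx hy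
        have hr2 : r ^ 2 ≤ 1 / 169 := by nlinarith
        have hr3 : r ^ 3 ≤ 1 / 2197 := by
          calc r ^ 3 ≤ (1 / 13) ^ 3 := pow_le_pow_left₀ hr hr1 3
            _ = 1 / 2197 := by norm_num
        linarith [hb r k hr hk1, hb r _ hr hk2, hb r _ hr hk3,
          hb (r ^ 2) k (by positivity) hk1, hb (r ^ 2) _ (by positivity) hk2,
          hb (r ^ 2) _ (by positivity) hk3, hb (r ^ 3) k (by positivity) hk1,
          hb (r ^ 3) _ (by positivity) hk2, hb (r ^ 3) _ (by positivity) hk3, sq_nonneg r]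
      linarith
    refine pos_of_mul_pos_right (a := 2 * d) ?_ (by positivity)
    have : 2 * d * ((dx - fx) * (gy - fy) - (dy - fy) * (gx - fx)) =
        2 * d * ((dx - fx) * (gy - fy)) - (dy - fy) * m := by
      rw [hgx]; linear_combination -(dy - fy) * he
    rw [this]; exact h1
  have hEF' : (3 * r - fx) ^ 2 + 3 * (2 * r + 1 - fy) ^ 2 = fx ^ 2 + 3 * fy ^ 2 := by
    rw [hfx, hfy]; ring
  have hT : 0 ≤ q * t * r := by positivity
  refine ⟨{
    t := t, T := q * t * r
    xD := t * dx, yD := q * t * dy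
    xE := 3 * t * r, yE := q * t * (2 * r + 1)
    xF := t * fx, yF := q * t * fy
    xG := t * gx, yG := q * t * gy
    xH := t * ((dx + gx) / 2 + 3 / 2 * (gy - dy))
    yH := q * t * ((dy + gy) / 2 - (gx - dx) / 2)
    xJ := t * ((fx + gx) / 2 - 3 / 2 * (gy - fy))
    yJ := q * t * ((fy + gy) / 2 + (gx - fx) / 2)
    t_pos := ht0
    T_nonneg := hT
    dist_AB := ?_, angle_D := ?_, dist_CD := ?_, angle_E := ?_, dist_BE := ?_, dist_AF := ?_
    dist_EF := ?_, dist_FG := ?_, dist_DG := ?_, dist_DH := ?_, dist_GH := ?_, dist_FJ := ?_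
    dist_GJ := ?_, ortho := ?_, side_D := ?_, side_E := ?_, side_F := ?_, side_G := ?_
    side_H := ?_, side_J := ?_ }⟩
  · linear_combination hsc + t ^ 2 * r ^ 2 * hq3
  · rw [hdx, hdy]; linear_combination 3 / 2 * hsc + t ^ 2 * r * (3 / 2 * (r + 1)) * hq3
  · rw [hdx, hdy]; linear_combination 9 * hsc + t ^ 2 * (3 / 2 * (r + 1)) ^ 2 * hq3
  · linear_combination -hsc - t ^ 2 * r * (r + 1) * hq3
  · linear_combination 4 * hsc + t ^ 2 * (r + 1) ^ 2 * hq3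
  · linear_combination hEF + t ^ 2 * fy ^ 2 * hq3
  · linear_combination hEF + t ^ 2 * hEF' + t ^ 2 * (2 * r + 1 - fy) ^ 2 * hq3
  · linear_combination t ^ 2 * hFG + hsc + t ^ 2 * (fy - gy) ^ 2 * hq3
  · linear_combination t ^ 2 * hDG + 4 * hsc + t ^ 2 * (dy - gy) ^ 2 * hq3
  · linear_combination t ^ 2 * hDG + 4 * hsc
      + t ^ 2 * ((dy - gy) / 2 + (gx - dx) / 2) ^ 2 * hq3
  · linear_combination t ^ 2 * hDG + 4 * hsc
      + t ^ 2 * ((gy - dy) / 2 + (gx - dx) / 2) ^ 2 * hq3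
  · linear_combination t ^ 2 * hFG + hsc
      + t ^ 2 * ((fy - gy) / 2 - (gx - fx) / 2) ^ 2 * hq3
  · linear_combination t ^ 2 * hFG + hsc
      + t ^ 2 * ((gy - fy) / 2 - (gx - fx) / 2) ^ 2 * hq3
  · linear_combination t / 2 * hH
  · have : orient t (q * t * r) (2 * t) 0 (t * dx) (q * t * dy)
        = q * t ^ 2 * (3 / 2 + 9 / 2 * r ^ 2) := by unfold orient; rw [hdx, hdy]; ring
    rw [this]; positivity
  · have : orient t (q * t * r) (2 * t) 0 (3 * t * r) (q * t * (2 * r + 1))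
        = q * t ^ 2 * (1 + 3 * r ^ 2) := by unfold orient; ring
    rw [this]; positivity
  · have : orient 0 0 (3 * t * r) (q * t * (2 * r + 1)) (t * fx) (q * t * fy)
        = q * t ^ 2 * (3 * r * fy - (2 * r + 1) * fx) := by unfold orient; ring
    rw [this]; positivity
  · have : orient (t * fx) (q * t * fy) (t * dx) (q * t * dy) (t * gx) (q * t * gy)
        = q * t ^ 2 * ((dx - fx) * (gy - fy) - (dy - fy) * (gx - fx)) := by unfold orient; ring
    rw [this]; positivity
  · unfold orient
    have : 0 < q * t ^ 2 * (1 + 3 * r ^ 2) := by positivity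
    linear_combination (-(q * t ^ 2) / 2) * hDG + 2 * this
  · unfold orient
    have : 0 < q * t ^ 2 * (1 + 3 * r ^ 2) := by positivity
    linear_combination (-(q * t ^ 2) / 2) * hFG + this / 2

/-! ### The four numbers as elements of `ℚ(r)` -/

/-- The polynomial with `PT = PTSq(X ^ 2)`. -/
noncomputable def PTSq : ℤ[X] :=
  -492075 + 52356780 * X - 1441635408 * X ^ 2 + 12222052416 * X ^ 3 - 60567699456 * X ^ 4
    + 189747007488 * X ^ 5 - 417660420096 * X ^ 6 + 607025037312 * X ^ 7 - 655053815808 * X ^ 8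
    + 446118756352 * X ^ 9 - 422064422912 * X ^ 10 + 437348466688 * X ^ 11

/-- The polynomial with `PyD = PyDSq(X ^ 2)`. -/
noncomputable def PyDSq : ℤ[X] :=
  -2470693585135788 + 1679453964496051893 * X - 2462573171102886288 * X ^ 2
    + 1847147913929328048 * X ^ 3 - 888334179987132288 * X ^ 4 + 302241307009227264 * X ^ 5
    - 74768143621533696 * X ^ 6 + 13516084620361728 * X ^ 7 - 1721332250836992 * X ^ 8
    + 139442448236544 * X ^ 9 - 6126808596480 * X ^ 10 + 109337116672 * X ^ 11

/-- The polynomial with `PyE = PyESq(X ^ 2)`. -/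
noncomputable def PyESq : ℤ[X] :=
  -387038865725307 + 255845547796716 * X - 1080696123714384 * X ^ 2 + 985178573370432 * X ^ 3
    + 290816529555456 * X ^ 4 + 1229422640467968 * X ^ 5 - 399291497201664 * X ^ 6
    - 226953868935168 * X ^ 7 - 145914316455936 * X ^ 8 + 84049703993344 * X ^ 9
    - 9462031056896 * X ^ 10 + 437348466688 * X ^ 11

/-- The polynomial with `PyF = PyFSq(X ^ 2)`. -/
noncomputable def PyFSq : ℤ[X] :=
  -6156736033068 + 4132620043369020 * X - 28069535202466347 * X ^ 2 + 54174190167055116 * X ^ 3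
    - 44321252355544320 * X ^ 4 + 16893977313239424 * X ^ 5 - 3430375146685440 * X ^ 6
    + 781964817629184 * X ^ 7 - 165954075623424 * X ^ 8 + 16400930701312 * X ^ 9
    - 579898179584 * X ^ 10 + 27334279168 * X ^ 11

lemma PT_eq_expand : PT = expand ℤ 2 PTSq := by
  simp only [PT, PTSq, map_add, map_sub, map_mul, map_neg, map_pow, map_ofNat, expand_X]
  ring

lemma PyD_eq_expand : PyD = expand ℤ 2 PyDSq := by
  simp only [PyD, PyDSq, map_add, map_sub, map_mul, map_neg, map_pow, map_ofNat, expand_X]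
  ring

lemma PyE_eq_expand : PyE = expand ℤ 2 PyESq := by
  simp only [PyE, PyESq, map_add, map_sub, map_mul, map_neg, map_pow, map_ofNat, expand_X]
  ring

lemma PyF_eq_expand : PyF = expand ℤ 2 PyFSq := by
  simp only [PyF, PyFSq, map_add, map_sub, map_mul, map_neg, map_pow, map_ofNat, expand_X]
  ring

/-- A polynomial of degree `11` vanishes at `N / M` if its homogenization vanishes at `(N, M)`.
Below, `M` and `N` are polynomials in `r`, and the homogenization is an explicit multiple of
`slopePoly`. -/
lemma eq_zero_of_homogenization {c₀ c₁ c₂ c₃ c₄ c₅ c₆ c₇ c₈ c₉ c₁₀ c₁₁ M N z : ℝ}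
    (hM : M ≠ 0) (hz : M * z = N)
    (h : c₀ * M ^ 11 + c₁ * N * M ^ 10 + c₂ * N ^ 2 * M ^ 9 + c₃ * N ^ 3 * M ^ 8
      + c₄ * N ^ 4 * M ^ 7 + c₅ * N ^ 5 * M ^ 6 + c₆ * N ^ 6 * M ^ 5 + c₇ * N ^ 7 * M ^ 4
      + c₈ * N ^ 8 * M ^ 3 + c₉ * N ^ 9 * M ^ 2 + c₁₀ * N ^ 10 * M + c₁₁ * N ^ 11 = 0) :
    c₀ + c₁ * z + c₂ * z ^ 2 + c₃ * z ^ 3 + c₄ * z ^ 4 + c₅ * z ^ 5 + c₆ * z ^ 6 + c₇ * z ^ 7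
      + c₈ * z ^ 8 + c₉ * z ^ 9 + c₁₀ * z ^ 10 + c₁₁ * z ^ 11 = 0 := by
  refine mul_left_cancel₀ (pow_ne_zero 11 hM) ?_
  rw [mul_zero, ← h, ← hz]
  ring

namespace IsParameter

variable {r k s : ℝ}

lemma sq_ratio_PT (h : IsParameter r k s) :
    (1 + 3 * r ^ 2) * (s * r) ^ 2 = 3 * r ^ 2 := by
  linear_combination r ^ 2 * h.scale

theorem aeval_PT_eq_zero (h : IsParameter r k s) :
    aeval (s * r) PT = 0 := by
  have hr := h.r_nonneg
  have hq := h.aeval_slopePoly_eq_zero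
  rw [aeval_slopePoly] at hq
  have := eq_zero_of_homogenization (c₀ := -492075)
    (c₁ := 52356780) (c₂ := -1441635408) (c₃ := 12222052416) (c₄ := -60567699456)
      (c₅ := 189747007488) (c₆ := -417660420096) (c₇ := 607025037312) (c₈ := -655053815808)
      (c₉ := 446118756352) (c₁₀ := -422064422912) (c₁₁ := 437348466688)
    (by positivity) h.sq_ratio_PT (by
      linear_combination 19683 * (5 - 35 * r - 593 * r ^ 2 + 8375 * r ^ 3 - 50574 * r ^ 4
        + 192738 * r ^ 5 - 541986 * r ^ 6 + 1225454 * r ^ 7 - 2267879 * r ^ 8 + 3157585 * r ^ 9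
        - 2836509 * r ^ 10 + 1105227 * r ^ 11) * hq)
  rw [PT_eq_expand, expand_aeval, PTSq]
  simp only [map_add, map_sub, map_mul, map_neg, map_pow, map_ofNat, aeval_X]
  linear_combination this

lemma sq_ratio_PyD (h : IsParameter r k s) :
    (4 + 12 * r ^ 2) * (s * (3 / 2 * (r + 1))) ^ 2 = 27 + 54 * r + 27 * r ^ 2 := by
  linear_combination 9 * (r + 1) ^ 2 * h.scale

theorem aeval_PyD_eq_zero (h : IsParameter r k s) :
    aeval (s * (3 / 2 * (r + 1))) PyD = 0 := by
  have hr := h.r_nonneg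
  have hq := h.aeval_slopePoly_eq_zero
  rw [aeval_slopePoly] at hq
  have := eq_zero_of_homogenization (c₀ := -2470693585135788)
    (c₁ := 1679453964496051893) (c₂ := -2462573171102886288) (c₃ := 1847147913929328048)
      (c₄ := -888334179987132288) (c₅ := 302241307009227264) (c₆ := -74768143621533696)
      (c₇ := 13516084620361728) (c₈ := -1721332250836992) (c₉ := 139442448236544)
      (c₁₀ := -6126808596480) (c₁₁ := 109337116672)
    (by positivity) h.sq_ratio_PyD (by
      linear_combination 2590709996727344037888 * (1390 - 3010 * r + 6269 * r ^ 2 - 4007 * r ^ 3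
        - 2112 * r ^ 4 + 1936 * r ^ 5 - 5722 * r ^ 6 + 3630 * r ^ 7 - 1958 * r ^ 8 + 1114 * r ^ 9
        - 171 * r ^ 10 + 81 * r ^ 11) * hq)
  rw [PyD_eq_expand, expand_aeval, PyDSq]
  simp only [map_add, map_sub, map_mul, map_neg, map_pow, map_ofNat, aeval_X]
  linear_combination this

lemma sq_ratio_PyE (h : IsParameter r k s) :
    (1 + 3 * r ^ 2) * (s * (2 * r + 1)) ^ 2 = 3 + 12 * r + 12 * r ^ 2 := by
  linear_combination (2 * r + 1) ^ 2 * h.scale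

theorem aeval_PyE_eq_zero (h : IsParameter r k s) :
    aeval (s * (2 * r + 1)) PyE = 0 := by
  have hr := h.r_nonneg
  have hq := h.aeval_slopePoly_eq_zero
  rw [aeval_slopePoly] at hq
  have := eq_zero_of_homogenization (c₀ := -387038865725307)
    (c₁ := 255845547796716) (c₂ := -1080696123714384) (c₃ := 985178573370432)
      (c₄ := 290816529555456) (c₅ := 1229422640467968) (c₆ := -399291497201664)
      (c₇ := -226953868935168) (c₈ := -145914316455936) (c₉ := 84049703993344)
      (c₁₀ := -9462031056896) (c₁₁ := 437348466688)
    (by positivity) h.sq_ratio_PyE (by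
      linear_combination 19683 * (2358519816745 + 27242148883825 * r + 132452535401147 * r ^ 2
        + 387396051635219 * r ^ 3 + 784264148155994 * r ^ 4 + 1199868190390058 * r ^ 5
        + 1459285791124854 * r ^ 6 + 1410352737869350 * r ^ 7 + 1010421710154061 * r ^ 8
        + 466277730138037 * r ^ 9 + 102724184555007 * r ^ 10 + 3331050498423 * r ^ 11) * hq)
  rw [PyE_eq_expand, expand_aeval, PyESq]
  simp only [map_add, map_sub, map_mul, map_neg, map_pow, map_ofNat, aeval_X]
  linear_combination this

/-- The denominator of `k` does not vanish: the curve equation forces `12 r < 1`. -/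
lemma k_denominator_pos (h : IsParameter r k s) :
    0 < 59 + 453 * r + 1038 * r ^ 2 - 782 * r ^ 3 - 6825 * r ^ 4 - 8919 * r ^ 5 := by
  have hr := h.r_nonneg
  have h1 : 12 * r < 1 := by
    have : 0 < k ^ 2 * (7 * r ^ 2 + 4 * r + 1) := by have := h.k_pos; positivity
    nlinarith [h.curve]
  have hp : ∀ n, r ^ n ≤ 1 := fun n => pow_le_one₀ hr (by linarith)
  have h2 : r ^ 2 * (782 * r + 6825 * r ^ 2 + 8919 * r ^ 3) ≤
      r ^ 2 * (782 * r + 6825 * r + 8919 * r) := by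
    gcongr <;> nlinarith [hp 1, hp 2]
  nlinarith

/-- The square of `y_F` as a fraction whose numerator and denominator have degree `5` in `r`. Modulo
`slopePoly`, of degree `11`, every element of `ℚ(r)` can be written in this way. -/
lemma sq_ratio_PyF (h : IsParameter r k s) :
    (3784037830340 + 26978411593724 * r + 79288925732936 * r ^ 2 + 152001597872088 * r ^ 3
      + 223603555689204 * r ^ 4 + 318281371177644 * r ^ 5) * (s * ((2 * r + 1 + k * r) / 2)) ^ 2 =
      2740492055085 + 35442733771683 * r + 158203340141142 * r ^ 2 + 278121556531458 * r ^ 3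
      - 13642288573683 * r ^ 4 - 159410591534133 * r ^ 5 := by
  have hq := h.aeval_slopePoly_eq_zero
  rw [aeval_slopePoly] at hq
  have hk := h.k_eq
  have hd := h.k_denominator_pos
  have hr := h.r_nonneg
  set d := 59 + 453 * r + 1038 * r ^ 2 - 782 * r ^ 3 - 6825 * r ^ 4 - 8919 * r ^ 5 with hd'
  set n := 49 - 89 * r - 2342 * r ^ 2 - 8586 * r ^ 3 - 9963 * r ^ 4 - 189 * r ^ 5 with hn'
  refine mul_left_cancel₀ (by positivity : 4 * (1 + 3 * r ^ 2) * d ^ 2 ≠ 0) ?_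
  have hw : 4 * (1 + 3 * r ^ 2) * d ^ 2 * (s * ((2 * r + 1 + k * r) / 2)) ^ 2 =
      3 * ((2 * r + 1) * d + r * n) ^ 2 := by
    linear_combination ((2 * r + 1) * d + k * r * d) ^ 2 * h.scale
      + 3 * r * ((2 * r + 1) * d + r * n + (2 * r + 1) * d + k * r * d) * hk
  rw [hd', hn'] at hw
  rw [hd']
  linear_combination (3784037830340 + 26978411593724 * r + 79288925732936 * r ^ 2
    + 152001597872088 * r ^ 3 + 223603555689204 * r ^ 4 + 318281371177644 * r ^ 5) * hw
    + (-271619137447416 - 4656766235730984 * r - 21650589573692688 * r ^ 2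
    - 22352870536136784 * r ^ 3 + 100308449499661224 * r ^ 4 + 359155159705775736 * r ^ 5
    + 418437927521469792 * r ^ 6) * hq

theorem aeval_PyF_eq_zero (h : IsParameter r k s) :
    aeval (s * ((2 * r + 1 + k * r) / 2)) PyF = 0 := by
  have hr := h.r_nonneg
  have hq := h.aeval_slopePoly_eq_zero
  rw [aeval_slopePoly] at hq
  have := eq_zero_of_homogenization (c₀ := -6156736033068)
    (c₁ := 4132620043369020) (c₂ := -28069535202466347) (c₃ := 54174190167055116)
      (c₄ := -44321252355544320) (c₅ := 16893977313239424) (c₆ := -3430375146685440)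
      (c₇ := 781964817629184) (c₈ := -165954075623424) (c₉ := 16400930701312)
      (c₁₀ := -579898179584) (c₁₁ := 27334279168)
    (by positivity) h.sq_ratio_PyF (by
      linear_combination
        10319560704 * (18063978882230737973303567833930302538612898190664379480994457366669281758244195323241191533762788431979643714694672268456847395390755380859375
        + 1072253993603463380722081184535025506349731312594762886683654711232490844906445150918890175486053002035112953796687462506978876188793006332031250 * r
        + 30171263456724056229065807517834315517912788773528783420946510070446861518881469752325485648510889576307892545216732341241958392025903018567968750 * r ^ 2
        + 535485216403883181777141757596973922683686448485234915655312269419818705317758245853402452616141103284885533325476599972363641929625926954040781250 * r ^ 3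
        + 6735218215106985242723089773551673471326971901226712972923837423594442046749295622682658352038118897536466941444784467006778761731031158050055828125 * r ^ 4
        + 64089660265154725032831048679364682611634281450846321709801873334400753489502898236465059041384926166998340224620457732838085425555671672833413612500 * r ^ 5
        + 483243872355851098375558463433300947011672883384042504657539462913773102954470151117385479364676997621590689377496389337571785318365557264338988182500 * r ^ 6
        + 3012860647863783510871326575213562010247250061275237495368908358396306867523977123918948780393526752023437518154195112957914256872274506919079436394500 * r ^ 7
        + 16305462705636888508251551195171540105927306183427371623966429826943111350034557174325658423060275938770975560922842676205436123575432629029285502799125 * r ^ 8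
        + 80969162139211231449904133501885661957242461681353822988589766105045595775394622598350421698264788741968539762755456754181904149616779985158237298756450 * r ^ 9
        + 385963761196173000389302511275537948807950213081836269718381692307734445280573915138896996622776108710905396833299292742821445657677493916968386163696550 * r ^ 10
        + 1782570723563143315089032406651660133582196864532109013368991149672608126168319109353986124052277825604468818397409205679873682944107200612627721494096450 * r ^ 11
        + 7768551521733317315566397993921374891963660926913661776204600078177241542286383571531668790001948505067675236269238868977206725083753026974857756902050975 * r ^ 12
        + 30840835361266201564723531319067250764331619109860532842861348217582320410451610684463917099679519178964788632554331778066711369369702466996047786135476400 * r ^ 13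
        + 108899916070538055095459451919121510358252527744886808911212382922344873616092420429663008965058070952957662610892392592431537270664586660463912493428517680 * r ^ 14
        + 338876103262414310380177106977464355571323744352831638659540630666523996695929780550802999772471607741141111533997393347786928783688725549919896032114910320 * r ^ 15
        + 932015914867602195156054679366482649312894540486852922433443187635559684898745784872016965090492425352454371256620462538556453947491266365015751206721718630 * r ^ 16
        + 2299274903021193916611434540530277409442982759383556177916163036441920726360226522776663782917530134119568031680977197227367751146077967825358769871723835428 * r ^ 17
        + 5248304454636875832932994033169017906484555843990050853479644152789654535786400200078298562160130281272758368594162451775419451982926955062214384118150110588 * r ^ 18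
        + 11671069303310756692724561412069308914411137623582796246228395376186683751186684958334863546107361768978779716409170796532010542687198916102062630430400724292 * r ^ 19
        + 26805007155600144746870417226811790743189599880915893341446175593462481843307896087388212671165945416035595870948867721443479887028802217853764507731238829522 * r ^ 20
        + 65022215643410026451312943986235196214196428753467794928324217767297367264701405843564300407183821171306493214687973084353243621101305323412326435203965997880 * r ^ 21
        + 160432292479329208056233669904965487652959209629364556196380634572611939589142464787079677540010373849152667303382039347171033486683571513961962660213766381400 * r ^ 22
        + 377188937019924140909780732963819510451412354698100333988011536051352212392119537084927918994665256325056158007669061524489518452895797413316641333626356625368 * r ^ 23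
        + 797045616680373298198143300837342218928927333942018542171272927755674841403667936441856021588750813485194089273370361230084192586201715461256257000460499567802 * r ^ 24
        + 1434551585053016941201857595580018128912382185225401382805037979775105331091427352650198912102233428607813299885246712970587492997551382142821000173563799588308 * r ^ 25
        + 2014842804783719923794284126864841990131506358616516005026540130979665757688593276535801442254322385553482572329713081936166900844027516517967958555714553382556 * r ^ 26
        + 1596994259178001615937933205361277712938069949028904148640876423083251210111286377939668828173040120881658387533300958488897953998275239074222119130877717368148 * r ^ 27
        - 1804315782152761200367127418629982389913662707845029294072797232895815693033409662493186963241479361288065430547099455922261130214860980375229507683935789393554 * r ^ 28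
        - 11172403959662311052490947620042487135853867397287712783189960258023635559651393109060496767258546488106576437624389219585024884967067134535029398868538292967888 * r ^ 29
        - 29413761312603911225258860873265400525994447041884660711264764107835657248982531578466125641024477958860043463239755094812767721321881878899980971080582598423504 * r ^ 30
        - 56953147107405337318274760277091469510823271222619930456379804792179219408957528236069857672923551521094036918608107062949291018649731388788895712941755355998992 * r ^ 31
        - 88761279505795763722074345094815986555684070636599549109477019930854571802813956640042377016564113183241215723560973502252932298187537723002578444619458149943461 * r ^ 32
        - 113024404579931413748779569343880021205552318794995998428750575129108894593716608471430647378382763964127635014331604597592804780691135747169838989177781627569910 * r ^ 33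
        - 114195306324670470673936126154323691291450956483312806976889147816549191143744435534922036639821365617865568085226248332958707634888105167164950529845836378694122 * r ^ 34
        - 81335544151166493444175021380964139024573838682405869662630881892223958163029609656164966229471098447897729138020362422334943302901900649952957524812239511058502 * r ^ 35
        - 18218753892657115031356466329031990865552001569856322828054003002322220443007196975242094678518925917130373191105798597245798869208015656237164699916591698643679 * r ^ 36
        + 52893905202858911254027758597788150176831689306707638492565026033413940067599160019945547166066649172811966790584419757575303062307654136587298617488868520889876 * r ^ 37
        + 100436112535556392782377723084563461661915753474623576018649174911546028310201677961237226927302201176916769289477525738829785930957447702008702013030505849786724 * r ^ 38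
        + 102071363774254425309420292494554802069753116899438305714869835344868994400765071975879548134241666487064823424731958558744665420067127720670262351155939769289412 * r ^ 39
        + 60558417394288752000770960637992550631913596720237180208502861108118822357952423212735919096539689814357567592114131038049246236188214168076758272703246904419201 * r ^ 40
        + 6027635034952490585262759292456182620670340461030738049089103281669561225930600200421693375299650736352874015121189359001811644338243558399375846283720299997322 * r ^ 41
        - 24221306859741445389751570577005800289496953738009539310444766831928770700149126324254678312850345949572115868791143483270538608280201876172614478948104434688450 * r ^ 42
        - 20342565146582172675670630310685366367313823222192623220443065458049608041097715905448178133439410308656247178071472708737598059968634622643444533031198470896214 * r ^ 43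
        - 5747768594480273633525604609431157100668741304097055926577334654587434847874604100187802527289007337273812358965044384123581353507550596065142374120126753510301 * r ^ 44) * hq)
  rw [PyF_eq_expand, expand_aeval, PyFSq]
  simp only [map_add, map_sub, map_mul, map_neg, map_pow, map_ofNat, aeval_X]
  linear_combination this

end IsParameter

/-! ### Irreducibility criteria -/

/-- A version of `Polynomial.Monic.irreducible_of_irreducible_map` in which a primitive polynomial
whose degree is preserved replaces a monic one. -/
lemma irreducible_of_irreducible_map_of_natDegree_eq {R S : Type*} [CommRing R] [IsDomain R]
    [CommRing S] [IsDomain S] (φ : R →+* S) {p : R[X]} (hp : p.IsPrimitive)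
    (hdeg : (p.map φ).natDegree = p.natDegree) (hirr : Irreducible (p.map φ)) :
    Irreducible p := by
  have key : ∀ a b : R[X], p = a * b → IsUnit (a.map φ) → IsUnit a := by
    intro a b hab ha
    have h0 : a.map φ ≠ 0 := ha.ne_zero
    have hb0 : b.map φ ≠ 0 := by
      intro h; apply hirr.ne_zero; rw [hab, Polynomial.map_mul, h, mul_zero]
    have ha' : a ≠ 0 := fun h => h0 (by rw [h, Polynomial.map_zero])
    have hb' : b ≠ 0 := fun h => hb0 (by rw [h, Polynomial.map_zero])
    rw [hab, Polynomial.map_mul, natDegree_mul h0 hb0, natDegree_mul ha' hb',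
      natDegree_eq_zero_of_isUnit ha] at hdeg
    have := natDegree_map_le (f := φ) (p := b)
    have hn : a.natDegree = 0 := by omega
    rw [natDegree_eq_zero] at hn
    obtain ⟨c, rfl⟩ := hn
    exact isUnit_C.mpr (hp c ⟨b, hab⟩)
  refine ⟨fun h => hirr.not_isUnit (h.map (mapRingHom φ)), fun a b hab => ?_⟩
  rcases hirr.isUnit_or_isUnit (by rw [hab, Polynomial.map_mul]) with h | h
  · exact Or.inl (key a b hab h)
  · exact Or.inr (key b a (hab.trans (mul_comm a b)) h)

/-- Rabin's irreducibility test for polynomials of prime degree over a finite prime field. -/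
lemma irreducible_of_dvd_X_pow_sub_X {p n : ℕ} [Fact p.Prime] (hn : n.Prime) {f : (ZMod p)[X]}
    (hdeg : f.natDegree = n) (hdvd : f ∣ X ^ p ^ n - X) (hroot : ∀ a, f.eval a ≠ 0) :
    Irreducible f := by
  have hf0 : f ≠ 0 := by rintro rfl; exact hn.pos.ne (by simpa using hdeg)
  have hfu : ¬ IsUnit f := fun h => hn.pos.ne' (hdeg ▸ natDegree_eq_zero_of_isUnit h)
  obtain ⟨g, hg, hgf⟩ := WfDvdMonoid.exists_irreducible_factor hfu hf0
  have hgn : g.natDegree ∣ n :=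
    hg.natDegree_dvd_of_dvd_X_pow_card_pow_sub_X (by simpa using hgf.trans hdvd)
  rcases (Nat.dvd_prime hn).mp hgn with h1 | h1
  · obtain ⟨a, ha⟩ := exists_root_of_degree_eq_one (degree_eq_iff_natDegree_eq hg.ne_zero |>.mpr h1)
    exact absurd (ha.dvd hgf) (hroot a)
  · obtain ⟨c, hc⟩ := hgf
    have hc0 : c ≠ 0 := by rintro rfl; exact hf0 (by simpa using hc)
    have hcn : c.natDegree = 0 := by
      have := natDegree_mul hg.ne_zero hc0
      rw [← hc] at this
      omega
    have hcu : IsUnit c := isUnit_iff_degree_eq_zero.mpr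
      ((degree_eq_iff_natDegree_eq hc0).mpr hcn)
    rw [hc]
    exact (irreducible_mul_isUnit hcu).mpr hg

/-- An integer polynomial without roots modulo a prime not dividing its leading coefficient has no
rational roots. -/
lemma aeval_rat_ne_zero_of_forall_zmod {p : ℤ[X]} (ℓ : ℕ) [Fact ℓ.Prime]
    (hlc : (p.leadingCoeff : ZMod ℓ) ≠ 0) (h : ∀ a : ZMod ℓ, aeval a p ≠ 0) (x : ℚ) :
    aeval x p ≠ 0 := by
  intro hx
  have hnum := num_isRoot_scaleRoots_of_aeval_eq_zero (A := ℤ) hx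
  set a := IsFractionRing.num ℤ x
  set b : ℤ := (IsFractionRing.den ℤ x : ℤ)
  obtain ⟨c, hc⟩ : b ∣ p.leadingCoeff := den_dvd_of_is_root hx
  have hb : (b : ZMod ℓ) ≠ 0 := by
    intro hb
    apply hlc
    rw [hc, Int.cast_mul, hb, zero_mul]
  refine h (a / b) ?_
  have h1 := scaleRoots_eval₂_mul (p := p) (Int.castRingHom (ZMod ℓ)) (a / b : ZMod ℓ) b
  rw [eq_intCast, mul_div_cancel₀ _ hb] at h1
  have h2 : eval₂ (Int.castRingHom (ZMod ℓ)) (a : ZMod ℓ) (scaleRoots p b) = 0 := by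
    have := eval₂_at_apply (p := scaleRoots p b) (Int.castRingHom (ZMod ℓ)) a
    rw [eq_intCast] at this
    rw [this, hnum.eq_zero, map_zero]
  rw [h2] at h1
  exact (mul_eq_zero.mp h1.symm).resolve_left (pow_ne_zero _ hb)

section RealNumbers

open IntermediateField Module

lemma natDegree_minpoly_of_mem_adjoin {x z : ℝ} (hx : (minpoly ℚ x).natDegree.Prime)
    (hz : z ∈ ℚ⟮x⟯) (hq : ∀ q : ℚ, (q : ℝ) ≠ z) :
    (minpoly ℚ z).natDegree = (minpoly ℚ x).natDegree := by
  have hxi : IsIntegral ℚ x := by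
    by_contra h
    rw [minpoly.eq_zero h, natDegree_zero] at hx
    exact Nat.not_prime_zero hx
  have : FiniteDimensional ℚ ℚ⟮x⟯ := adjoin.finiteDimensional hxi
  have hdvd : finrank ℚ ℚ⟮z⟯ ∣ finrank ℚ ℚ⟮x⟯ :=
    finrank_dvd_of_le_right (adjoin_simple_le_iff.mpr hz)
  have hzi : IsIntegral ℚ z := by
    have := (IsIntegral.of_finite ℚ (⟨z, hz⟩ : ℚ⟮x⟯)).map ℚ⟮x⟯.val
    exact this
  rw [adjoin.finrank hxi, adjoin.finrank hzi] at hdvd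
  refine ((Nat.dvd_prime hx).mp hdvd).resolve_left fun h1 => ?_
  obtain ⟨q, hq'⟩ := minpoly.natDegree_eq_one_iff.mp h1
  exact hq q hq'

/-- If the norm of `y ^ 2` is not the square of a rational number then `y` has twice the degree of
`y ^ 2`. The hypothesis on the norm is expressed through the coefficients of an integer polynomial
`p` of least degree which vanishes at `y ^ 2`. -/
lemma natDegree_minpoly_of_sq {y : ℝ} {p : ℤ[X]} (hodd : Odd p.natDegree)
    (hp : aeval (y ^ 2) p = 0) (hdeg : (minpoly ℚ (y ^ 2)).natDegree = p.natDegree)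
    (hsq : ¬ IsSquare (-(p.coeff 0 * p.leadingCoeff))) :
    (minpoly ℚ y).natDegree = 2 * p.natDegree := by
  set z := y ^ 2 with hz
  have hp0 : p ≠ 0 := by
    rintro rfl
    simp at hodd
  have hlc : (p.leadingCoeff : ℚ) ≠ 0 := by exact_mod_cast leadingCoeff_ne_zero.mpr hp0
  have hinj : Function.Injective (Int.castRingHom ℚ) := Int.cast_injective
  have hzi : IsIntegral ℚ z := by
    by_contra h
    rw [minpoly.eq_zero h, natDegree_zero] at hdeg
    rw [← hdeg] at hodd
    simp at hodd
  have hyi : IsIntegral ℚ y := IsIntegral.of_pow two_pos hzi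
  have : FiniteDimensional ℚ ℚ⟮y⟯ := adjoin.finiteDimensional hyi
  have : FiniteDimensional ℚ ℚ⟮z⟯ := adjoin.finiteDimensional hzi
  have hle : ℚ⟮z⟯ ≤ ℚ⟮y⟯ := adjoin_simple_le_iff.mpr (pow_mem (mem_adjoin_simple_self ℚ y) 2)
  have hdvd : finrank ℚ ℚ⟮z⟯ ∣ finrank ℚ ℚ⟮y⟯ := finrank_dvd_of_le_right hle
  have hupper : (minpoly ℚ y).natDegree ≤ 2 * p.natDegree := by
    have h0 : expand ℚ 2 (minpoly ℚ z) ≠ 0 :=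
      (expand_ne_zero two_pos).mpr (minpoly.ne_zero hzi)
    have h1 := natDegree_le_natDegree (minpoly.degree_le_of_ne_zero ℚ y h0
      (by rw [expand_aeval, ← hz, minpoly.aeval]))
    rwa [natDegree_expand, hdeg, mul_comm] at h1
  rw [adjoin.finrank hzi, adjoin.finrank hyi, hdeg] at hdvd
  obtain ⟨m, hm⟩ := hdvd
  have hpos := hodd.pos
  have hm2 : m ≤ 2 := by
    rw [hm, mul_comm] at hupper
    exact Nat.le_of_mul_le_mul_right hupper hpos
  have hm0 : m ≠ 0 := by
    rintro rfl
    exact (minpoly.natDegree_pos hyi).ne' (by simpa using hm)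
  rcases (by omega : m = 1 ∨ m = 2) with rfl | rfl
  swap
  · rw [hm, mul_comm]
  exfalso
  rw [mul_one] at hm
  -- now `y ∈ ℚ(z)`, so the norm of `z = y ^ 2` is a square
  have heq : ℚ⟮z⟯ = ℚ⟮y⟯ := eq_of_le_of_finrank_eq hle
    (by rw [adjoin.finrank hzi, adjoin.finrank hyi, hdeg, hm])
  have hy : y ∈ ℚ⟮z⟯ := heq ▸ mem_adjoin_simple_self ℚ y
  have hgen : AdjoinSimple.gen ℚ z = (⟨y, hy⟩ : ℚ⟮z⟯) ^ 2 := by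
    apply Subtype.ext
    simp [hz]
  have hnorm := Algebra.PowerBasis.norm_gen_eq_coeff_zero_minpoly (adjoin.powerBasis hzi)
  rw [adjoin.powerBasis_gen, hgen, map_pow, ← hgen, minpoly_gen, adjoin.powerBasis_dim, hdeg,
    hodd.neg_one_pow] at hnorm
  obtain ⟨ν, hν⟩ : ∃ ν : ℚ, ν ^ 2 = -1 * (minpoly ℚ z).coeff 0 := ⟨_, hnorm⟩
  have hmin : p.map (Int.castRingHom ℚ) = C (p.leadingCoeff : ℚ) * minpoly ℚ z := by
    have hd : minpoly ℚ z ∣ p.map (Int.castRingHom ℚ) :=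
      minpoly.dvd ℚ z ((aeval_map_algebraMap ℚ z p).trans hp)
    have := eq_leadingCoeff_mul_of_monic_of_dvd_of_natDegree_le (minpoly.monic hzi) hd
      (by rw [natDegree_map_eq_of_injective hinj, hdeg])
    rwa [leadingCoeff_map_of_injective hinj, eq_intCast] at this
  have hcoeff : (p.coeff 0 : ℚ) = p.leadingCoeff * (minpoly ℚ z).coeff 0 := by
    have := congrArg (fun f => f.coeff 0) hmin
    simpa using this
  apply hsq
  rw [← Rat.isSquare_intCast_iff]
  refine ⟨p.leadingCoeff * ν, ?_⟩
  push_cast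
  rw [hcoeff]
  linear_combination -(p.leadingCoeff : ℚ) ^ 2 * hν

/-- A primitive polynomial whose degree is that of its root `y` over `ℚ` is, up to a unit, the minimal
polynomial over `ℚ`; the properties over `ℤ` follow from Gauss's lemma. -/
lemma isMinimalPolynomial_and_irreducible {P : ℤ[X]} {y : ℝ} (hprim : P.IsPrimitive)
    (hlc : 0 < P.leadingCoeff) (hroot : aeval y P = 0)
    (hdeg : (minpoly ℚ y).natDegree = P.natDegree) (hpos : 0 < P.natDegree) :
    IsMinimalPolynomial P y ∧ Irreducible P ∧ ∀ R : ℤ[X], aeval y R = 0 → P ∣ R := by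
  have hinj : Function.Injective (Int.castRingHom ℚ) := Int.cast_injective
  have hyi : IsIntegral ℚ y := by
    by_contra h
    rw [minpoly.eq_zero h, natDegree_zero] at hdeg
    omega
  have hd : minpoly ℚ y ∣ P.map (Int.castRingHom ℚ) :=
    minpoly.dvd ℚ y ((aeval_map_algebraMap ℚ y P).trans hroot)
  have hP := eq_leadingCoeff_mul_of_monic_of_dvd_of_natDegree_le (minpoly.monic hyi) hd
    (by rw [natDegree_map_eq_of_injective hinj, hdeg])
  rw [leadingCoeff_map_of_injective hinj, eq_intCast] at hP
  have hu : IsUnit (C (P.leadingCoeff : ℚ)) :=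
    isUnit_C.mpr (IsUnit.mk0 _ (by exact_mod_cast hlc.ne'))
  refine ⟨⟨hprim, hlc, hroot, fun Q hQ hQy => ?_⟩, ?_, fun R hR => ?_⟩
  · rw [← hdeg, ← natDegree_map_eq_of_injective hinj Q]
    exact natDegree_le_natDegree (minpoly.degree_le_of_ne_zero ℚ y
      ((Polynomial.map_ne_zero_iff hinj).mpr hQ) ((aeval_map_algebraMap ℚ y Q).trans hQy))
  · rw [IsPrimitive.Int.irreducible_iff_irreducible_map_cast hprim, hP]
    exact (irreducible_isUnit_mul hu).mpr (minpoly.irreducible hyi)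
  · rw [IsPrimitive.Int.dvd_iff_map_cast_dvd_map_cast P R hprim, hP]
    exact hu.mul_left_dvd.mpr (minpoly.dvd ℚ y ((aeval_map_algebraMap ℚ y R).trans hR))

end RealNumbers

/-! ### Irreducibility of the polynomial of `r` -/

set_option maxHeartbeats 2000000 in
/-- In characteristic `17`, if `x` is a root of `slopePoly` (made monic), then the `11`-th iterate of
the Frobenius map fixes `x`. Reducing the powers `x ^ (17 j)` with `j ≤ 10` to polynomials in `x` of
degree at most `10` gives the matrix of the Frobenius map, which is then applied repeatedly. -/
theorem pow_frobenius_eq_self {S : Type*} [CommRing S] [CharP S 17] {x : S}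
    (hx : 2 + 14 * x + 11 * x ^ 2 + 16 * x ^ 3 + 14 * x ^ 4 + 10 * x ^ 5 + 10 * x ^ 6 + 10 * x ^ 7
        + 16 * x ^ 8 + 15 * x ^ 9 + 7 * x ^ 10 + x ^ 11 = 0) : x ^ 17 ^ 11 = x := by
  have h17 : (17 : S) = 0 := by exact_mod_cast CharP.cast_eq_zero S 17
  have : Fact (Nat.Prime 17) := ⟨by norm_num⟩
  -- the images of the powers of `x`
  have e1 : x ^ 17 = 8 + 4 * x + 8 * x ^ 2 + 9 * x ^ 3 + 11 * x ^ 4 + 9 * x ^ 5 + 16 * x ^ 7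
      + 9 * x ^ 8 := by
    linear_combination (13 + 9 * x + 6 * x ^ 2 + 4 * x ^ 3 + 10 * x ^ 5 + x ^ 6) * hx + (-2
      - 12 * x - 17 * x ^ 2 - 24 * x ^ 3 - 27 * x ^ 4 - 25 * x ^ 5 - 30 * x ^ 6 - 28 * x ^ 7
      - 34 * x ^ 8 - 35 * x ^ 9 - 28 * x ^ 10 - 20 * x ^ 11 - 13 * x ^ 12 - 12 * x ^ 13
      - 10 * x ^ 14 - 5 * x ^ 15 - x ^ 16) * h17
  have e2 : x ^ 34 = 16 * x + 2 * x ^ 2 + 2 * x ^ 3 + 9 * x ^ 4 + 4 * x ^ 5 + 14 * x ^ 7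
      + 4 * x ^ 8 + 15 * x ^ 9
        + 7 * x ^ 10 := by
    linear_combination x ^ 17 * e1 + (9 * x + 4 * x ^ 2 + 15 * x ^ 3 + 9 * x ^ 4 + 4 * x ^ 5
      + 10 * x ^ 6 + 16 * x ^ 7 + 4 * x ^ 8 + 7 * x ^ 9 + 15 * x ^ 10 + 11 * x ^ 11 + 7 * x ^ 12
      + 4 * x ^ 13 + 9 * x ^ 14) * hx + (-2 * x - 8 * x ^ 2 - 11 * x ^ 3 - 25 * x ^ 4 - 29 * x ^ 5
      - 33 * x ^ 6 - 42 * x ^ 7 - 48 * x ^ 8 - 53 * x ^ 9 - 62 * x ^ 10 - 70 * x ^ 11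
      - 71 * x ^ 12 - 69 * x ^ 13 - 65 * x ^ 14 - 67 * x ^ 15 - 57 * x ^ 16 - 48 * x ^ 17
      - 43 * x ^ 18 - 38 * x ^ 19 - 30 * x ^ 20 - 20 * x ^ 21 - 15 * x ^ 22 - 10 * x ^ 23
      - 3 * x ^ 24) * h17
  have e3 : x ^ 51 = 2 + 2 * x + 9 * x ^ 2 + 12 * x ^ 3 + 16 * x ^ 4 + 16 * x ^ 5 + 13 * x ^ 6
      + 3 * x ^ 7
        + 4 * x ^ 8 + 13 * x ^ 10 := by
    linear_combination x ^ 17 * e2 + (16 + 6 * x + 10 * x ^ 2 + x ^ 3 + 8 * x ^ 4 + 9 * x ^ 5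
      + 13 * x ^ 6 + x ^ 7 + 12 * x ^ 8 + 16 * x ^ 9 + 15 * x ^ 10 + 3 * x ^ 11 + 4 * x ^ 12
      + 14 * x ^ 13 + x ^ 14 + 7 * x ^ 16) * hx + (-2 - 14 * x - 17 * x ^ 2 - 28 * x ^ 3
      - 28 * x ^ 4 - 33 * x ^ 5 - 37 * x ^ 6 - 44 * x ^ 7 - 51 * x ^ 8 - 63 * x ^ 9 - 67 * x ^ 10
      - 66 * x ^ 11 - 64 * x ^ 12 - 66 * x ^ 13 - 70 * x ^ 14 - 58 * x ^ 15 - 56 * x ^ 16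
      - 58 * x ^ 17 - 50 * x ^ 18 - 41 * x ^ 19 - 28 * x ^ 20 - 23 * x ^ 21 - 19 * x ^ 22
      - 11 * x ^ 23 - 7 * x ^ 24 - 6 * x ^ 25 - 2 * x ^ 26) * h17
  have e4 : x ^ 68 = 11 + 2 * x + 8 * x ^ 2 + 14 * x ^ 3 + 8 * x ^ 4 + 13 * x ^ 5 + 13 * x ^ 6
      + 8 * x ^ 7
        + 8 * x ^ 8 + 4 * x ^ 9 + 14 * x ^ 10 := by
    linear_combination x ^ 17 * e3 + (3 + 12 * x + 6 * x ^ 2 + 14 * x ^ 3 + 3 * x ^ 4 + 12 * x ^ 5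
      + 4 * x ^ 6 + 15 * x ^ 7 + 10 * x ^ 8 + 6 * x ^ 9 + 7 * x ^ 10 + 7 * x ^ 11 + 2 * x ^ 12
      + 10 * x ^ 13 + 4 * x ^ 14 + 11 * x ^ 15 + 13 * x ^ 16) * hx + (-1 - 4 * x - 13 * x ^ 2
      - 18 * x ^ 3 - 30 * x ^ 4 - 31 * x ^ 5 - 40 * x ^ 6 - 40 * x ^ 7 - 52 * x ^ 8 - 60 * x ^ 9
      - 65 * x ^ 10 - 67 * x ^ 11 - 61 * x ^ 12 - 56 * x ^ 13 - 57 * x ^ 14 - 55 * x ^ 15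
      - 61 * x ^ 16 - 60 * x ^ 17 - 50 * x ^ 18 - 46 * x ^ 19 - 36 * x ^ 20 - 30 * x ^ 21
      - 27 * x ^ 22 - 25 * x ^ 23 - 24 * x ^ 24 - 16 * x ^ 25 - 6 * x ^ 26) * h17
  have e5 : x ^ 85 = 2 + 8 * x + 11 * x ^ 2 + 14 * x ^ 3 + 7 * x ^ 5 + 2 * x ^ 6 + 2 * x ^ 7
      + 5 * x ^ 8
        + 16 * x ^ 9 + 15 * x ^ 10 := by
    linear_combination x ^ 17 * e4 + (16 + 3 * x + 13 * x ^ 2 + 4 * x ^ 3 + 11 * x ^ 4 + 7 * x ^ 5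
      + 3 * x ^ 6 + 12 * x ^ 7 + 12 * x ^ 8 + 12 * x ^ 9 + 11 * x ^ 10 + 2 * x ^ 11 + 6 * x ^ 12
      + 8 * x ^ 13 + 14 * x ^ 14 + 8 * x ^ 15 + 14 * x ^ 16) * hx + (-2 - 14 * x - 15 * x ^ 2
      - 29 * x ^ 3 - 29 * x ^ 4 - 37 * x ^ 5 - 39 * x ^ 6 - 41 * x ^ 7 - 56 * x ^ 8 - 62 * x ^ 9
      - 68 * x ^ 10 - 68 * x ^ 11 - 63 * x ^ 12 - 62 * x ^ 13 - 58 * x ^ 14 - 63 * x ^ 15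
      - 68 * x ^ 16 - 74 * x ^ 17 - 64 * x ^ 18 - 53 * x ^ 19 - 41 * x ^ 20 - 35 * x ^ 21
      - 35 * x ^ 22 - 31 * x ^ 23 - 26 * x ^ 24 - 16 * x ^ 25 - 6 * x ^ 26) * h17
  have e6 : x ^ 102 = 6 + 9 * x + 10 * x ^ 2 + 5 * x ^ 3 + 14 * x ^ 4 + 15 * x ^ 5 + 3 * x ^ 6
      + 13 * x ^ 8
        + 13 * x ^ 9 + 5 * x ^ 10 := by
    linear_combination x ^ 17 * e5 + (14 + 8 * x + 15 * x ^ 2 + 12 * x ^ 4 + 11 * x ^ 5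
      + 6 * x ^ 6 + 16 * x ^ 7 + 2 * x ^ 8 + 15 * x ^ 9 + 5 * x ^ 10 + 6 * x ^ 11 + 6 * x ^ 12
      + 10 * x ^ 13 + 12 * x ^ 14 + 13 * x ^ 15 + 15 * x ^ 16) * hx + (-2 - 13 * x - 18 * x ^ 2
      - 31 * x ^ 3 - 31 * x ^ 4 - 41 * x ^ 5 - 43 * x ^ 6 - 47 * x ^ 7 - 65 * x ^ 8 - 65 * x ^ 9
      - 75 * x ^ 10 - 64 * x ^ 11 - 62 * x ^ 12 - 63 * x ^ 13 - 63 * x ^ 14 - 67 * x ^ 15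
      - 69 * x ^ 16 - 73 * x ^ 17 - 64 * x ^ 18 - 57 * x ^ 19 - 46 * x ^ 20 - 41 * x ^ 21
      - 39 * x ^ 22 - 36 * x ^ 23 - 31 * x ^ 24 - 19 * x ^ 25 - 6 * x ^ 26) * h17
  have e7 : x ^ 119 = 8 + 14 * x + x ^ 2 + 10 * x ^ 3 + 6 * x ^ 4 + 15 * x ^ 5 + 3 * x ^ 6
      + 13 * x ^ 7
        + 16 * x ^ 8 + 9 * x ^ 9 + 14 * x ^ 10 := by
    linear_combination x ^ 17 * e6 + (13 + 4 * x + 2 * x ^ 2 + 8 * x ^ 3 + 11 * x ^ 4 + 9 * x ^ 5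
      + x ^ 6 + 4 * x ^ 7 + x ^ 8 + x ^ 9 + 16 * x ^ 10 + 16 * x ^ 11 + 14 * x ^ 13 + 7 * x ^ 14
      + 12 * x ^ 15 + 5 * x ^ 16) * hx + (-2 - 12 * x - 12 * x ^ 2 - 18 * x ^ 3 - 24 * x ^ 4
      - 29 * x ^ 5 - 34 * x ^ 6 - 36 * x ^ 7 - 43 * x ^ 8 - 40 * x ^ 9 - 36 * x ^ 10 - 44 * x ^ 11
      - 52 * x ^ 12 - 53 * x ^ 13 - 58 * x ^ 14 - 49 * x ^ 15 - 53 * x ^ 16 - 52 * x ^ 17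
      - 54 * x ^ 18 - 56 * x ^ 19 - 44 * x ^ 20 - 34 * x ^ 21 - 29 * x ^ 22 - 26 * x ^ 23
      - 19 * x ^ 24 - 9 * x ^ 25 - 2 * x ^ 26) * h17
  have e8 : x ^ 136 = 7 + x + 15 * x ^ 2 + 2 * x ^ 3 + 12 * x ^ 5 + 11 * x ^ 6 + 11 * x ^ 7
      + 8 * x ^ 8
        + 9 * x ^ 9 + 9 * x ^ 10 := by
    linear_combination x ^ 17 * e7 + (5 + 7 * x + x ^ 2 + 7 * x ^ 3 + 16 * x ^ 4 + 8 * x ^ 5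
      + 8 * x ^ 6 + x ^ 7 + 11 * x ^ 8 + 13 * x ^ 9 + 6 * x ^ 10 + 15 * x ^ 12 + 8 * x ^ 13
      + 4 * x ^ 14 + 13 * x ^ 15 + 14 * x ^ 16) * hx + (-1 - 5 * x - 10 * x ^ 2 - 11 * x ^ 3
      - 19 * x ^ 4 - 29 * x ^ 5 - 33 * x ^ 6 - 41 * x ^ 7 - 42 * x ^ 8 - 51 * x ^ 9 - 54 * x ^ 10
      - 54 * x ^ 11 - 59 * x ^ 12 - 66 * x ^ 13 - 58 * x ^ 14 - 54 * x ^ 15 - 61 * x ^ 16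
      - 65 * x ^ 17 - 59 * x ^ 18 - 51 * x ^ 19 - 43 * x ^ 20 - 39 * x ^ 21 - 32 * x ^ 22
      - 28 * x ^ 23 - 26 * x ^ 24 - 17 * x ^ 25 - 6 * x ^ 26) * h17
  have e9 : x ^ 153 = 15 + 9 * x + 5 * x ^ 2 + 7 * x ^ 3 + 13 * x ^ 4 + 10 * x ^ 5 + 15 * x ^ 6
      + 14 * x ^ 7
        + 8 * x ^ 8 + 16 * x ^ 9 + x ^ 10 := by
    linear_combination x ^ 17 * e8 + (1 + 14 * x + 13 * x ^ 2 + 16 * x ^ 3 + 14 * x ^ 4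
      + 10 * x ^ 5 + 2 * x ^ 6 + 2 * x ^ 7 + 12 * x ^ 8 + 12 * x ^ 9 + 2 * x ^ 10 + 7 * x ^ 12
      + 8 * x ^ 13 + 13 * x ^ 14 + 14 * x ^ 15 + 9 * x ^ 16) * hx + (-1 - 3 * x - 14 * x ^ 2
      - 23 * x ^ 3 - 38 * x ^ 4 - 48 * x ^ 5 - 53 * x ^ 6 - 52 * x ^ 7 - 52 * x ^ 8 - 63 * x ^ 9
      - 70 * x ^ 10 - 70 * x ^ 11 - 65 * x ^ 12 - 57 * x ^ 13 - 47 * x ^ 14 - 48 * x ^ 15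
      - 57 * x ^ 16 - 63 * x ^ 17 - 56 * x ^ 18 - 43 * x ^ 19 - 36 * x ^ 20 - 35 * x ^ 21
      - 35 * x ^ 22 - 33 * x ^ 23 - 26 * x ^ 24 - 14 * x ^ 25 - 4 * x ^ 26) * h17
  have e10 : x ^ 170 = 3 + 15 * x + 11 * x ^ 2 + x ^ 3 + 13 * x ^ 4 + 13 * x ^ 5 + 16 * x ^ 6
      + 8 * x ^ 7
        + 10 * x ^ 8 + 4 * x ^ 9 + 11 * x ^ 10 := by
    linear_combination x ^ 17 * e9 + (7 + 3 * x + 3 * x ^ 2 + 8 * x ^ 3 + x ^ 4 + 7 * x ^ 5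
      + 15 * x ^ 6 + 4 * x ^ 7 + 10 * x ^ 8 + 8 * x ^ 11 + 4 * x ^ 12 + 13 * x ^ 13 + 15 * x ^ 14
      + 9 * x ^ 15 + x ^ 16) * hx + (-1 - 7 * x - 8 * x ^ 2 - 12 * x ^ 3 - 18 * x ^ 4 - 17 * x ^ 5
      - 25 * x ^ 6 - 33 * x ^ 7 - 37 * x ^ 8 - 47 * x ^ 9 - 41 * x ^ 10 - 39 * x ^ 11
      - 40 * x ^ 12 - 38 * x ^ 13 - 52 * x ^ 14 - 58 * x ^ 15 - 57 * x ^ 16 - 49 * x ^ 17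
      - 40 * x ^ 18 - 35 * x ^ 19 - 33 * x ^ 20 - 33 * x ^ 21 - 33 * x ^ 22 - 27 * x ^ 23
      - 15 * x ^ 24 - 5 * x ^ 25) * h17
  -- the orbit of `x`
  have f2 : (8 + 4 * x + 8 * x ^ 2 + 9 * x ^ 3 + 11 * x ^ 4 + 9 * x ^ 5 + 16 * x ^ 7 + 9 * x ^ 8) ^ 17 =
      14 + 13 * x + 8 * x ^ 2 + 6 * x ^ 3 + 2 * x ^ 4 + x ^ 5 + 4 * x ^ 7 + 4 * x ^ 8 + 6 * x ^ 9
        + 2 * x ^ 10 := by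
    rw [← frobenius_def]
    simp only [map_add, map_mul, map_pow, map_ofNat]
    simp only [frobenius_def, ← pow_mul, Nat.reduceMul]
    linear_combination 4 * e1 + 8 * e2 + 9 * e3 + 11 * e4 + 9 * e5 + 16 * e7 + 9 * e8 + (22
      + 28 * x + 27 * x ^ 2 + 36 * x ^ 3 + 26 * x ^ 4 + 45 * x ^ 5 + 25 * x ^ 6 + 36 * x ^ 7
      + 33 * x ^ 8 + 31 * x ^ 9 + 45 * x ^ 10) * h17
  have f3 : (14 + 13 * x + 8 * x ^ 2 + 6 * x ^ 3 + 2 * x ^ 4 + x ^ 5 + 4 * x ^ 7 + 4 * x ^ 8 + 6 * x ^ 9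
        + 2 * x ^ 10) ^ 17 =
      4 + 8 * x + 11 * x ^ 2 + 16 * x ^ 3 + 13 * x ^ 4 + 13 * x ^ 5 + 12 * x ^ 6 + 8 * x ^ 7
        + x ^ 8 + 14 * x ^ 9 + 8 * x ^ 10 := by
    rw [← frobenius_def]
    simp only [map_add, map_mul, map_pow, map_ofNat]
    simp only [frobenius_def, ← pow_mul, Nat.reduceMul]
    linear_combination 13 * e1 + 8 * e2 + 6 * e3 + 2 * e4 + 1 * e5 + 4 * e7 + 4 * e8 + 6 * e9
      + 2 * e10 + (18 + 20 * x + 18 * x ^ 2 + 19 * x ^ 3 + 26 * x ^ 4 + 27 * x ^ 5 + 16 * x ^ 6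
      + 32 * x ^ 7 + 21 * x ^ 8 + 18 * x ^ 9 + 17 * x ^ 10) * h17
  have f4 : (4 + 8 * x + 11 * x ^ 2 + 16 * x ^ 3 + 13 * x ^ 4 + 13 * x ^ 5 + 12 * x ^ 6 + 8 * x ^ 7
        + x ^ 8 + 14 * x ^ 9 + 8 * x ^ 10) ^ 17 =
      4 * x + 13 * x ^ 2 + 14 * x ^ 3 + 12 * x ^ 4 + 15 * x ^ 5 + 13 * x ^ 6 + 2 * x ^ 7
        + 10 * x ^ 10 := by
    rw [← frobenius_def]
    simp only [map_add, map_mul, map_pow, map_ofNat]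
    simp only [frobenius_def, ← pow_mul, Nat.reduceMul]
    linear_combination 8 * e1 + 11 * e2 + 16 * e3 + 13 * e4 + 13 * e5 + 12 * e6 + 8 * e7 + 1 * e8
      + 14 * e9 + 8 * e10 + (38 + 49 * x + 45 * x ^ 2 + 52 * x ^ 3 + 61 * x ^ 4 + 69 * x ^ 5
      + 47 * x ^ 6 + 49 * x ^ 7 + 49 * x ^ 8 + 54 * x ^ 9 + 55 * x ^ 10) * h17
  have f5 : (4 * x + 13 * x ^ 2 + 14 * x ^ 3 + 12 * x ^ 4 + 15 * x ^ 5 + 13 * x ^ 6 + 2 * x ^ 7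
        + 10 * x ^ 10) ^ 17 =
      6 + 11 * x + 7 * x ^ 2 + 6 * x ^ 3 + 6 * x ^ 4 + 10 * x ^ 5 + 12 * x ^ 6 + 10 * x ^ 7
        + 4 * x ^ 8 + 13 * x ^ 9 + 2 * x ^ 10 := by
    rw [← frobenius_def]
    simp only [map_add, map_mul, map_pow, map_ofNat]
    simp only [frobenius_def, ← pow_mul, Nat.reduceMul]
    linear_combination 4 * e1 + 13 * e2 + 14 * e3 + 12 * e4 + 15 * e5 + 13 * e6 + 2 * e7
      + 10 * e10 + (20 + 40 * x + 40 * x ^ 2 + 41 * x ^ 3 + 47 * x ^ 4 + 54 * x ^ 5 + 33 * x ^ 6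
      + 30 * x ^ 7 + 36 * x ^ 8 + 41 * x ^ 9 + 51 * x ^ 10) * h17
  have f6 : (6 + 11 * x + 7 * x ^ 2 + 6 * x ^ 3 + 6 * x ^ 4 + 10 * x ^ 5 + 12 * x ^ 6 + 10 * x ^ 7
        + 4 * x ^ 8 + 13 * x ^ 9 + 2 * x ^ 10) ^ 17 =
      12 + 13 * x + 13 * x ^ 2 + 7 * x ^ 3 + 3 * x ^ 4 + 4 * x ^ 5 + 3 * x ^ 6 + x ^ 7 + 7 * x ^ 8
        + 5 * x ^ 9 + 3 * x ^ 10 := by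
    rw [← frobenius_def]
    simp only [map_add, map_mul, map_pow, map_ofNat]
    simp only [frobenius_def, ← pow_mul, Nat.reduceMul]
    linear_combination 11 * e1 + 7 * e2 + 6 * e3 + 6 * e4 + 10 * e5 + 12 * e6 + 10 * e7 + 4 * e8
      + 13 * e9 + 2 * e10 + (33 + 38 * x + 34 * x ^ 2 + 39 * x ^ 3 + 44 * x ^ 4 + 53 * x ^ 5
      + 30 * x ^ 6 + 43 * x ^ 7 + 42 * x ^ 8 + 46 * x ^ 9 + 37 * x ^ 10) * h17
  have f7 : (12 + 13 * x + 13 * x ^ 2 + 7 * x ^ 3 + 3 * x ^ 4 + 4 * x ^ 5 + 3 * x ^ 6 + x ^ 7 + 7 * x ^ 8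
        + 5 * x ^ 9 + 3 * x ^ 10) ^ 17 =
      7 + 8 * x + 13 * x ^ 2 + 11 * x ^ 3 + 4 * x ^ 4 + 3 * x ^ 5 + 10 * x ^ 6 + 15 * x ^ 7
        + 14 * x ^ 8 + 15 * x ^ 9 + 6 * x ^ 10 := by
    rw [← frobenius_def]
    simp only [map_add, map_mul, map_pow, map_ofNat]
    simp only [frobenius_def, ← pow_mul, Nat.reduceMul]
    linear_combination 13 * e1 + 13 * e2 + 7 * e3 + 3 * e4 + 4 * e5 + 3 * e6 + 1 * e7 + 7 * e8
      + 5 * e9 + 3 * e10 + (19 + 26 * x + 26 * x ^ 2 + 23 * x ^ 3 + 32 * x ^ 4 + 34 * x ^ 5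
      + 20 * x ^ 6 + 36 * x ^ 7 + 24 * x ^ 8 + 27 * x ^ 9 + 24 * x ^ 10) * h17
  have f8 : (7 + 8 * x + 13 * x ^ 2 + 11 * x ^ 3 + 4 * x ^ 4 + 3 * x ^ 5 + 10 * x ^ 6 + 15 * x ^ 7
        + 14 * x ^ 8 + 15 * x ^ 9 + 6 * x ^ 10) ^ 17 =
      1 + 6 * x ^ 2 + 4 * x ^ 3 + 15 * x ^ 4 + 5 * x ^ 5 + 3 * x ^ 6 + 2 * x ^ 7 + 10 * x ^ 8
        + 13 * x ^ 9 + 3 * x ^ 10 := by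
    rw [← frobenius_def]
    simp only [map_add, map_mul, map_pow, map_ofNat]
    simp only [frobenius_def, ← pow_mul, Nat.reduceMul]
    linear_combination 8 * e1 + 13 * e2 + 11 * e3 + 4 * e4 + 3 * e5 + 10 * e6 + 15 * e7 + 14 * e8
      + 15 * e9 + 6 * e10 + (39 + 49 * x + 42 * x ^ 2 + 39 * x ^ 3 + 53 * x ^ 4 + 67 * x ^ 5
      + 44 * x ^ 6 + 58 * x ^ 7 + 51 * x ^ 8 + 53 * x ^ 9 + 47 * x ^ 10) * h17
  have f9 : (1 + 6 * x ^ 2 + 4 * x ^ 3 + 15 * x ^ 4 + 5 * x ^ 5 + 3 * x ^ 6 + 2 * x ^ 7 + 10 * x ^ 8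
        + 13 * x ^ 9 + 3 * x ^ 10) ^ 17 =
      16 + 10 * x + 10 * x ^ 2 + 13 * x ^ 3 + 7 * x ^ 4 + 2 * x ^ 5 + 13 * x ^ 6 + 7 * x ^ 7
        + 11 * x ^ 8 + 2 * x ^ 9 + 14 * x ^ 10 := by
    rw [← frobenius_def]
    simp only [map_add, map_mul, map_pow, map_ofNat, map_one]
    simp only [frobenius_def, ← pow_mul, Nat.reduceMul]
    linear_combination 6 * e2 + 4 * e3 + 15 * e4 + 5 * e5 + 3 * e6 + 2 * e7 + 10 * e8 + 13 * e9
      + 3 * e10 + (28 + 23 * x + 29 * x ^ 2 + 28 * x ^ 3 + 29 * x ^ 4 + 40 * x ^ 5 + 36 * x ^ 6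
      + 33 * x ^ 7 + 27 * x ^ 8 + 35 * x ^ 9 + 32 * x ^ 10) * h17
  have f10 : (16 + 10 * x + 10 * x ^ 2 + 13 * x ^ 3 + 7 * x ^ 4 + 2 * x ^ 5 + 13 * x ^ 6 + 7 * x ^ 7
        + 11 * x ^ 8 + 2 * x ^ 9 + 14 * x ^ 10) ^ 17 =
      10 + 13 * x + 13 * x ^ 2 + 16 * x ^ 3 + 12 * x ^ 4 + 6 * x ^ 5 + 2 * x ^ 6 + 3 * x ^ 7
        + 8 * x ^ 8 + 3 * x ^ 10 := by
    rw [← frobenius_def]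
    simp only [map_add, map_mul, map_pow, map_ofNat]
    simp only [frobenius_def, ← pow_mul, Nat.reduceMul]
    linear_combination 10 * e1 + 10 * e2 + 13 * e3 + 7 * e4 + 2 * e5 + 13 * e6 + 7 * e7 + 11 * e8
      + 2 * e9 + 14 * e10 + (28 + 41 * x + 44 * x ^ 2 + 33 * x ^ 3 + 52 * x ^ 4 + 63 * x ^ 5
      + 41 * x ^ 6 + 44 * x ^ 7 + 45 * x ^ 8 + 37 * x ^ 9 + 46 * x ^ 10) * h17
  have f11 : (10 + 13 * x + 13 * x ^ 2 + 16 * x ^ 3 + 12 * x ^ 4 + 6 * x ^ 5 + 2 * x ^ 6 + 3 * x ^ 7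
        + 8 * x ^ 8 + 3 * x ^ 10) ^ 17 =
      x := by
    rw [← frobenius_def]
    simp only [map_add, map_mul, map_pow, map_ofNat]
    simp only [frobenius_def, ← pow_mul, Nat.reduceMul]
    linear_combination 13 * e1 + 13 * e2 + 16 * e3 + 12 * e4 + 6 * e5 + 2 * e6 + 3 * e7 + 8 * e8
      + 3 * e10 + (23 + 28 * x + 36 * x ^ 2 + 38 * x ^ 3 + 41 * x ^ 4 + 49 * x ^ 5 + 31 * x ^ 6
      + 41 * x ^ 7 + 31 * x ^ 8 + 28 * x ^ 9 + 42 * x ^ 10) * h17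
  calc x ^ 17 ^ 11
      = ((((((((((x ^ 17) ^ 17) ^ 17) ^ 17) ^ 17) ^ 17) ^ 17) ^ 17) ^ 17) ^ 17) ^ 17 := by
        simp only [← pow_mul, Nat.reduceMul, Nat.reducePow]
    _ = x := by rw [e1, f2, f3, f4, f5, f6, f7, f8, f9, f10, f11]

lemma natDegree_slopePoly : slopePoly.natDegree = 11 := by
  unfold slopePoly; compute_degree!

lemma leadingCoeff_slopePoly : slopePoly.leadingCoeff = 1105227 := by
  rw [leadingCoeff, natDegree_slopePoly, slopePoly]
  simp [coeff_X]

/-- A polynomial with two coprime coefficients is primitive. -/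
lemma isPrimitive_of_coeff {p : ℤ[X]} (i j : ℕ) (u v : ℤ)
    (h : u * p.coeff i + v * p.coeff j = 1) : p.IsPrimitive := fun r hr => by
  rw [C_dvd_iff_dvd_coeff] at hr
  exact isUnit_of_dvd_one (h ▸ dvd_add ((hr i).mul_left u) ((hr j).mul_left v))

lemma isPrimitive_slopePoly : slopePoly.IsPrimitive := by
  refine isPrimitive_of_coeff 0 2 237 2 ?_
  simp [slopePoly, coeff_X]

/-- `slopePoly` is irreducible modulo `17`, by Rabin's test. -/
theorem irreducible_slopePoly : Irreducible slopePoly := by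
  have hroot : ∀ a : ZMod 17, -5 - 35 * a + 593 * a ^ 2 + 8375 * a ^ 3 + 50574 * a ^ 4
      + 192738 * a ^ 5 + 541986 * a ^ 6 + 1225454 * a ^ 7 + 2267879 * a ^ 8 + 3157585 * a ^ 9
      + 2836509 * a ^ 10 + 1105227 * a ^ 11 ≠ 0 := by decide
  have hlc : ((1105227 : ℤ) : ZMod 17) ≠ 0 := by decide
  have : Fact (Nat.Prime 17) := ⟨by norm_num⟩
  have hdeg : (slopePoly.map (Int.castRingHom (ZMod 17))).natDegree = 11 := by
    rw [natDegree_map_of_leadingCoeff_ne_zero, natDegree_slopePoly]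
    rw [leadingCoeff_slopePoly]
    exact hlc
  refine irreducible_of_irreducible_map_of_natDegree_eq (Int.castRingHom (ZMod 17))
    isPrimitive_slopePoly (hdeg.trans natDegree_slopePoly.symm)
    (irreducible_of_dvd_X_pow_sub_X (by norm_num : Nat.Prime 11) hdeg ?_ ?_)
  · rw [← AdjoinRoot.mk_eq_zero, map_sub, map_pow, AdjoinRoot.mk_X, sub_eq_zero]
    set f := slopePoly.map (Int.castRingHom (ZMod 17)) with hf
    have : Nontrivial (AdjoinRoot f) := AdjoinRoot.nontrivial _ (by
      rw [degree_eq_natDegree (by rintro h; simp [h] at hdeg), hdeg]; norm_num)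
    have : CharP (AdjoinRoot f) 17 := charP_of_injective_algebraMap
      (algebraMap (ZMod 17) (AdjoinRoot f)).injective 17
    have h17 : (17 : AdjoinRoot f) = 0 := by exact_mod_cast CharP.cast_eq_zero (AdjoinRoot f) 17
    have h0 : AdjoinRoot.mk f f = 0 := AdjoinRoot.mk_self
    conv at h0 => lhs; arg 2; rw [hf, slopePoly]
    simp only [Polynomial.map_add, Polynomial.map_sub, Polynomial.map_mul, Polynomial.map_neg,
      Polynomial.map_pow, Polynomial.map_ofNat, map_X, map_add, map_sub, map_mul, map_neg,
      map_pow, map_ofNat, AdjoinRoot.mk_X] at h0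
    set x := AdjoinRoot.root f
    apply pow_frobenius_eq_self
    linear_combination 3 * h0 + (1 + 7 * x - 104 * x ^ 2 - 1477 * x ^ 3 - 8924 * x ^ 4
        - 34012 * x ^ 5 - 95644 * x ^ 6 - 216256 * x ^ 7 - 400213 * x ^ 8 - 557220 * x ^ 9
        - 500560 * x ^ 10 - 195040 * x ^ 11) * h17
  · intro a
    rw [eval_map, slopePoly]
    simp only [eval₂_add, eval₂_sub, eval₂_mul, eval₂_neg, eval₂_pow, eval₂_ofNat, eval₂_X]
    exact hroot a

/-! ### The minimal polynomials -/

section MinimalPolynomials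

open IntermediateField

lemma natDegree_minpoly_of_aeval_slopePoly {r : ℝ} (hr : aeval r slopePoly = 0) :
    (minpoly ℚ r).natDegree = 11 := by
  have hinj : Function.Injective (Int.castRingHom ℚ) := Int.cast_injective
  have hirr : Irreducible (slopePoly.map (Int.castRingHom ℚ)) :=
    (IsPrimitive.Int.irreducible_iff_irreducible_map_cast isPrimitive_slopePoly).mp
      irreducible_slopePoly
  have := minpoly.eq_of_irreducible hirr ((aeval_map_algebraMap ℚ r slopePoly).trans hr)
  rw [← this, natDegree_mul_C (inv_ne_zero (leadingCoeff_ne_zero.mpr hirr.ne_zero)),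
    natDegree_map_eq_of_injective hinj, natDegree_slopePoly]

/-- For a number `y` with `y ^ 2 ∈ ℚ(r)`, a polynomial `p` of degree `11` which vanishes at `y ^ 2`
is its minimal polynomial unless `y ^ 2` is rational, which is excluded modulo `11`. Then
`p(X ^ 2)` is the minimal polynomial of `y` as `y ∉ ℚ(r)` by the condition on the norm. -/
theorem isMinimalPolynomial_expand {r y : ℝ} (hr : aeval r slopePoly = 0)
    (hy : y ^ 2 ∈ ℚ⟮r⟯) {P p : ℤ[X]} (hP : P = expand ℤ 2 p) (hdeg : p.natDegree = 11)
    (hprim : P.IsPrimitive) (hroot : aeval y P = 0) (hlc : 0 < p.leadingCoeff)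
    (hlc' : (p.leadingCoeff : ZMod 11) ≠ 0) (hmod : ∀ a : ZMod 11, aeval a p ≠ 0)
    (hsq : ¬ IsSquare (-(p.coeff 0 * p.leadingCoeff))) :
    IsMinimalPolynomial P y ∧ P.natDegree = 22 ∧ IsEven P ∧ Irreducible P ∧
      ∀ R : ℤ[X], aeval y R = 0 → P ∣ R := by
  have : Fact (Nat.Prime 11) := ⟨by norm_num⟩
  have hroot' : aeval (y ^ 2) p = 0 := by rwa [hP, expand_aeval] at hroot
  have hr11 := natDegree_minpoly_of_aeval_slopePoly hr
  have hirrat : ∀ q : ℚ, (q : ℝ) ≠ y ^ 2 := by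
    intro q hq
    refine aeval_rat_ne_zero_of_forall_zmod 11 hlc' hmod q ((algebraMap ℚ ℝ).injective ?_)
    rw [map_zero, ← aeval_algebraMap_apply, eq_ratCast, hq, hroot']
  have h11 : (minpoly ℚ (y ^ 2)).natDegree = p.natDegree := by
    rw [natDegree_minpoly_of_mem_adjoin (by rw [hr11]; norm_num) hy hirrat, hr11, hdeg]
  have h22 := natDegree_minpoly_of_sq (by rw [hdeg]; decide) hroot' h11 hsq
  have hPdeg : P.natDegree = 22 := by rw [hP, natDegree_expand, hdeg]
  have hPlc : 0 < P.leadingCoeff := by rwa [hP, leadingCoeff_expand two_pos]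
  obtain ⟨hmin, hirr, hdvd⟩ := isMinimalPolynomial_and_irreducible hprim hPlc hroot
    (by rw [h22, hPdeg, hdeg]) (by rw [hPdeg]; norm_num)
  refine ⟨hmin, hPdeg, fun n hn => ?_, hirr, hdvd⟩
  rw [mem_support_iff, hP, coeff_expand two_pos] at hn
  exact even_iff_two_dvd.mpr (by_contra fun h => hn (if_neg h))

namespace IsParameter

variable {r k s : ℝ}

theorem isMinimalPolynomial_PyD (h : IsParameter r k s) :
    IsMinimalPolynomial PyD (s * (3 / 2 * (r + 1))) ∧ PyD.natDegree = 22 ∧ IsEven PyD ∧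
      Irreducible PyD ∧ ∀ R : ℤ[X], aeval (s * (3 / 2 * (r + 1))) R = 0 → PyD ∣ R := by
  have hdeg : PyDSq.natDegree = 11 := by unfold PyDSq; compute_degree!
  have hlc : PyDSq.leadingCoeff = 109337116672 := by
    rw [leadingCoeff, hdeg]; simp [PyDSq, coeff_X]
  have h0 : PyDSq.coeff 0 = -2470693585135788 := by simp [PyDSq]
  refine isMinimalPolynomial_expand h.aeval_slopePoly_eq_zero ?_ PyD_eq_expand hdeg ?_
    h.aeval_PyD_eq_zero (by rw [hlc]; norm_num) (by rw [hlc]; decide) ?_ ?_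
  · have hr := h.r_nonneg
    have hN := h.sq_ratio_PyD
    obtain ⟨R, hR⟩ : ∃ R : ℚ⟮r⟯, algebraMap ℚ⟮r⟯ ℝ R = r := ⟨AdjoinSimple.gen ℚ r, rfl⟩
    rw [mul_comm, ← eq_div_iff (by positivity)] at hN
    have hN' : algebraMap ℚ⟮r⟯ ℝ ((27 + 54 * R + 27 * R ^ 2) / (4 + 12 * R ^ 2)) = (s * (3 /
      2 * (r + 1))) ^ 2 := by
      simp only [map_div₀, map_add, map_mul, map_pow, map_ofNat, hR, hN]
    rw [← hN', IntermediateField.algebraMap_apply]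
    exact SetLike.coe_mem _
  · refine isPrimitive_of_coeff 22 2 (-26184968193587921) (1704714141) ?_
    simp [PyD]
  · intro a
    rw [PyDSq]
    simp only [map_add, map_sub, map_mul, map_neg, map_pow, map_ofNat, aeval_X]
    revert a
    decide
  · -- the number is not a square modulo `31`
    rw [h0, hlc]
    intro hs
    have := hs.map (Int.castRingHom (ZMod 31))
    revert this
    decide

theorem isMinimalPolynomial_PyE (h : IsParameter r k s) :
    IsMinimalPolynomial PyE (s * (2 * r + 1)) ∧ PyE.natDegree = 22 ∧ IsEven PyE ∧
      Irreducible PyE ∧ ∀ R : ℤ[X], aeval (s * (2 * r + 1)) R = 0 → PyE ∣ R := by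
  have hdeg : PyESq.natDegree = 11 := by unfold PyESq; compute_degree!
  have hlc : PyESq.leadingCoeff = 437348466688 := by
    rw [leadingCoeff, hdeg]; simp [PyESq, coeff_X]
  have h0 : PyESq.coeff 0 = -387038865725307 := by simp [PyESq]
  refine isMinimalPolynomial_expand h.aeval_slopePoly_eq_zero ?_ PyE_eq_expand hdeg ?_
    h.aeval_PyE_eq_zero (by rw [hlc]; norm_num) (by rw [hlc]; decide) ?_ ?_
  · have hr := h.r_nonneg
    have hN := h.sq_ratio_PyE
    obtain ⟨R, hR⟩ : ∃ R : ℚ⟮r⟯, algebraMap ℚ⟮r⟯ ℝ R = r := ⟨AdjoinSimple.gen ℚ r, rfl⟩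
    rw [mul_comm, ← eq_div_iff (by positivity)] at hN
    have hN' : algebraMap ℚ⟮r⟯ ℝ ((3 + 12 * R + 12 * R ^ 2) / (1 + 3 * R ^ 2)) = (s * (2 * r
      + 1)) ^ 2 := by
      simp only [map_div₀, map_add, map_mul, map_pow, map_ofNat, map_one, hR, hN]
    rw [← hN', IntermediateField.algebraMap_apply]
    exact SetLike.coe_mem _
  · refine isPrimitive_of_coeff 20 0 (86203837533184) (-2107445686195) ?_
    simp [PyE]
  · intro a
    rw [PyESq]
    simp only [map_add, map_sub, map_mul, map_neg, map_pow, map_ofNat, aeval_X]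
    revert a
    decide
  · -- the number is not a square modulo `31`
    rw [h0, hlc]
    intro hs
    have := hs.map (Int.castRingHom (ZMod 31))
    revert this
    decide

theorem isMinimalPolynomial_PyF (h : IsParameter r k s) :
    IsMinimalPolynomial PyF (s * ((2 * r + 1 + k * r) / 2)) ∧ PyF.natDegree = 22 ∧ IsEven PyF ∧
      Irreducible PyF ∧ ∀ R : ℤ[X], aeval (s * ((2 * r + 1 + k * r) / 2)) R = 0 → PyF ∣ R := by
  have hdeg : PyFSq.natDegree = 11 := by unfold PyFSq; compute_degree!
  have hlc : PyFSq.leadingCoeff = 27334279168 := by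
    rw [leadingCoeff, hdeg]; simp [PyFSq, coeff_X]
  have h0 : PyFSq.coeff 0 = -6156736033068 := by simp [PyFSq]
  refine isMinimalPolynomial_expand h.aeval_slopePoly_eq_zero ?_ PyF_eq_expand hdeg ?_
    h.aeval_PyF_eq_zero (by rw [hlc]; norm_num) (by rw [hlc]; decide) ?_ ?_
  · have hr := h.r_nonneg
    have hN := h.sq_ratio_PyF
    obtain ⟨R, hR⟩ : ∃ R : ℚ⟮r⟯, algebraMap ℚ⟮r⟯ ℝ R = r := ⟨AdjoinSimple.gen ℚ r, rfl⟩
    rw [mul_comm, ← eq_div_iff (by positivity)] at hN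
    have hN' : algebraMap ℚ⟮r⟯ ℝ ((2740492055085 + 35442733771683 * R + 158203340141142 * R ^ 2
      + 278121556531458 * R ^ 3 - 13642288573683 * R ^ 4 - 159410591534133 * R ^ 5) /
      (3784037830340 + 26978411593724 * R + 79288925732936 * R ^ 2 + 152001597872088 * R ^ 3
      + 223603555689204 * R ^ 4 + 318281371177644 * R ^ 5)) = (s * ((2 * r + 1 + k * r) /
      2)) ^ 2 := by
      simp only [map_div₀, map_add, map_sub, map_mul, map_pow, map_ofNat, hR, hN]
    rw [← hN', IntermediateField.algebraMap_apply]
    exact SetLike.coe_mem _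
  · refine isPrimitive_of_coeff 20 4 (3448277209609993) (-71239144579) ?_
    simp [PyF]
  · intro a
    rw [PyFSq]
    simp only [map_add, map_sub, map_mul, map_neg, map_pow, map_ofNat, aeval_X]
    revert a
    decide
  · -- the number is not a square modulo `31`
    rw [h0, hlc]
    intro hs
    have := hs.map (Int.castRingHom (ZMod 31))
    revert this
    decide

end IsParameter

end MinimalPolynomials

/-! ### The resultants -/

lemma natDegree_PT : PT.natDegree = 22 := by
  unfold PT; compute_degree!

/-- The resultant of `P(T, y)` and `P_T(T)` vanishes at `y` if the polynomials have a common
root `T`. -/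
lemma aeval_resultantPT_eq_zero {P : ℤ[X][X]} {T y : ℝ}
    (hP : eval₂ ((aeval y : ℤ[X] →ₐ[ℤ] ℝ) : ℤ[X] →+* ℝ) T P = 0) (hT : aeval T PT = 0) :
    aeval y (resultantPT P) = 0 := by
  have hdeg : (PT.map (C : ℤ →+* ℤ[X])).natDegree = 22 := by
    rw [natDegree_map_eq_of_injective C_injective, natDegree_PT]
  obtain ⟨p, q, -, -, h⟩ := exists_mul_add_mul_eq_C_resultant P (PT.map C)
    (m := P.natDegree) (n := (PT.map (C : ℤ →+* ℤ[X])).natDegree) le_rfl le_rfl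
    (Or.inr (by rw [hdeg]; norm_num))
  have h1 := congrArg (eval₂ ((aeval y : ℤ[X] →ₐ[ℤ] ℝ) : ℤ[X] →+* ℝ) T) h
  have h2 : eval₂ ((aeval y : ℤ[X] →ₐ[ℤ] ℝ) : ℤ[X] →+* ℝ) T (PT.map C) = 0 := by
    rw [eval₂_map, ← hT, aeval_def]
    congr 1
    exact RingHom.ext_int _ _
  rw [eval₂_add, eval₂_mul, eval₂_mul, eval₂_C, h2] at h1
  rw [hP, zero_mul, zero_mul, zero_add] at h1
  exact h1.symm

/-- Over `ℂ`, the resultant with respect to `T` is, up to a nonzero constant, the product of the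
polynomials `P(τ, y)` over the roots `τ` of `P_T`. So its degree is `22 d` if all factors have
degree `d`. -/
theorem natDegree_resultantPT {P : ℤ[X][X]} {d : ℕ} (hd : d ≠ 0)
    (h : ∀ τ : ℂ, aeval τ PT = 0 →
      ((P.map (mapRingHom (Int.castRingHom ℂ))).eval (C τ)).natDegree = d) :
    (resultantPT P).natDegree = 22 * d := by
  have hinj : Function.Injective (Int.castRingHom ℂ) := Int.cast_injective
  set g : ℂ[X] := PT.map (Int.castRingHom ℂ) with hg
  have hgdeg : g.natDegree = 22 := by rw [hg, natDegree_map_eq_of_injective hinj, natDegree_PT]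
  have hg0 : g ≠ 0 := by rintro h; rw [h] at hgdeg; simp at hgdeg
  have hsplit : g.Splits := IsAlgClosed.splits g
  have hcard : Multiset.card g.roots = g.natDegree := hsplit.natDegree_eq_card_roots.symm
  have hroots : (g.map (C : ℂ →+* ℂ[X])).roots = g.roots.map C :=
    (roots_map_of_injective_of_card_eq_natDegree C_injective hcard).symm
  have hmap : (PT.map (C : ℤ →+* ℤ[X])).map (mapRingHom (Int.castRingHom ℂ)) = g.map C := by
    rw [hg, Polynomial.map_map, Polynomial.map_map, mapRingHom_comp_C]
  have hres : (resultantPT P).map (Int.castRingHom ℂ) =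
      (-1) ^ (P.natDegree * 22) * (C g.leadingCoeff ^ P.natDegree *
        (g.roots.map fun τ => (P.map (mapRingHom (Int.castRingHom ℂ))).eval (C τ)).prod) := by
    rw [← coe_mapRingHom, resultantPT, ← resultant_map_map, hmap, resultant_comm]
    have h1 : (PT.map (C : ℤ →+* ℤ[X])).natDegree = (g.map (C : ℂ →+* ℂ[X])).natDegree := by
      rw [natDegree_map_eq_of_injective C_injective, natDegree_map_eq_of_injective C_injective,
        natDegree_PT, hgdeg]
    rw [h1, resultant_eq_prod_eval _ _ _ natDegree_map_le (hsplit.map C), hroots,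
      leadingCoeff_map_of_injective C_injective, Multiset.map_map,
      natDegree_map_eq_of_injective C_injective, hgdeg]
    rfl
  have hroot : ∀ τ ∈ g.roots, aeval τ PT = 0 := fun τ hτ => by
    rw [mem_roots hg0, IsRoot.def, hg, eval_map] at hτ
    rw [aeval_def]
    exact hτ
  have h0 : (0 : ℂ[X]) ∉ g.roots.map
      fun τ => (P.map (mapRingHom (Int.castRingHom ℂ))).eval (C τ) := by
    intro hmem
    obtain ⟨τ, hτ, h0⟩ := Multiset.mem_map.mp hmem
    apply hd
    rw [← h τ (hroot τ hτ), h0, natDegree_zero]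
  have hdeg : (g.roots.map (natDegree ∘ fun τ =>
      (P.map (mapRingHom (Int.castRingHom ℂ))).eval (C τ))) = g.roots.map fun _ => d :=
    Multiset.map_congr rfl fun τ hτ => h τ (hroot τ hτ)
  rw [← natDegree_map_eq_of_injective hinj, hres]
  have hu : (-1 : ℂ[X]) ^ (P.natDegree * 22) = 1 := by
    rw [mul_comm, pow_mul]; norm_num
  rw [hu, one_mul, ← C_pow, natDegree_C_mul (pow_ne_zero _ (leadingCoeff_ne_zero.mpr hg0)),
    natDegree_multiset_prod _ h0, Multiset.map_map, hdeg, Multiset.map_const',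
    Multiset.sum_replicate, hcard, hgdeg, smul_eq_mul]

theorem natDegree_resultantPT_PyDT : (resultantPT PyDT).natDegree = 44 := by
  refine natDegree_resultantPT (d := 2) two_ne_zero fun τ _ => ?_
  rw [PyDT]
  simp only [Polynomial.map_add, Polynomial.map_sub, Polynomial.map_mul, Polynomial.map_pow,
    Polynomial.map_ofNat, map_X, map_C, coe_mapRingHom, eval_add, eval_sub, eval_mul, eval_pow,
    eval_ofNat, eval_X, eval_C]
  trans (C (-4 : ℂ) * X ^ 2 + C (12 * τ) * X + C (27 - 36 * τ ^ 2)).natDegree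
  · congr 1
    simp only [map_sub, map_mul, map_pow, map_neg, map_ofNat]
    ring
  · exact natDegree_quadratic (by norm_num)

theorem natDegree_resultantPT_PyET : (resultantPT PyET).natDegree = 44 := by
  refine natDegree_resultantPT (d := 2) two_ne_zero fun τ _ => ?_
  rw [PyET]
  simp only [Polynomial.map_add, Polynomial.map_sub, Polynomial.map_mul, Polynomial.map_pow,
    Polynomial.map_neg, Polynomial.map_ofNat, map_X, map_C, coe_mapRingHom, eval_add, eval_sub,
    eval_mul, eval_neg, eval_pow, eval_ofNat, eval_X, eval_C]
  trans (C (1 : ℂ) * X ^ 2 + C (-4 * τ) * X + C (-3 + 7 * τ ^ 2)).natDegree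
  · congr 1
    simp only [map_add, map_mul, map_pow, map_neg, map_ofNat, map_one]
    ring
  · exact natDegree_quadratic one_ne_zero

theorem natDegree_resultantPT_PyFT : (resultantPT PyFT).natDegree = 88 := by
  refine natDegree_resultantPT (d := 4) four_ne_zero fun τ hτ => ?_
  -- a Bézout identity shows that the leading coefficient and `P_T` have no common root
  have hlead : 144 - 384 * τ ^ 2 + 1024 * τ ^ 4 ≠ 0 := by
    intro h
    rw [PT] at hτ
    simp only [map_add, map_sub, map_mul, map_neg, map_pow, map_ofNat, aeval_X] at hτ
    have : (18329010779943 : ℂ) = 0 := by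
      linear_combination (4272384 + 9407488 * τ ^ 2) * hτ + (2270149348527
        - 18286166126808 * τ ^ 2 + 564724080672768 * τ ^ 4 - 2659048979986944 * τ ^ 6
        + 4870015772332032 * τ ^ 8 + 5130815581716480 * τ ^ 10 - 21019826132877312 * τ ^ 12
        + 55871478744219648 * τ ^ 14 - 25083883338858496 * τ ^ 16 + 8736937229680640 * τ ^ 18
        - 64286725815402496 * τ ^ 20) / 16 * h
    norm_num at this
  rw [PyFT]
  simp only [Polynomial.map_add, Polynomial.map_sub, Polynomial.map_mul, Polynomial.map_pow,
    Polynomial.map_neg, Polynomial.map_ofNat, map_X, map_C, coe_mapRingHom, eval_add, eval_sub,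
    eval_mul, eval_neg, eval_pow, eval_ofNat, eval_X, eval_C]
  trans (C (144 - 384 * τ ^ 2 + 1024 * τ ^ 4) * X ^ 4
    + C (-576 * τ + 1536 * τ ^ 3 - 4096 * τ ^ 5) * X ^ 3
    + C (-216 + 1584 * τ ^ 2 - 5376 * τ ^ 4 + 9216 * τ ^ 6) * X ^ 2
    + C (432 * τ - 864 * τ ^ 3 + 6528 * τ ^ 5 - 10240 * τ ^ 7) * X
    + C (81 - 648 * τ ^ 2 + 144 * τ ^ 4 - 2304 * τ ^ 6 + 4096 * τ ^ 8)).natDegree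
  · congr 1
    simp only [map_add, map_sub, map_mul, map_pow, map_neg, map_ofNat]
    ring
  · compute_degree!

namespace IsParameter

variable {r k s : ℝ}

theorem aeval_resultantPT_PyDT (h : IsParameter r k s) :
    aeval (s * (3 / 2 * (r + 1))) (resultantPT PyDT) = 0 := by
  refine aeval_resultantPT_eq_zero ?_ h.aeval_PT_eq_zero
  simp only [PyDT, eval₂_add, eval₂_sub, eval₂_mul, eval₂_pow, eval₂_ofNat, eval₂_X,
    eval₂_C, RingHom.coe_coe, aeval_X]
  linear_combination -9 * h.scale

theorem aeval_resultantPT_PyET (h : IsParameter r k s) :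
    aeval (s * (2 * r + 1)) (resultantPT PyET) = 0 := by
  refine aeval_resultantPT_eq_zero ?_ h.aeval_PT_eq_zero
  simp only [PyET, eval₂_add, eval₂_sub, eval₂_neg, eval₂_mul, eval₂_pow, eval₂_ofNat, eval₂_X,
    eval₂_C, RingHom.coe_coe, aeval_X]
  linear_combination h.scale

theorem aeval_resultantPT_PyFT (h : IsParameter r k s) :
    aeval (s * ((2 * r + 1 + k * r) / 2)) (resultantPT PyFT) = 0 := by
  refine aeval_resultantPT_eq_zero ?_ h.aeval_PT_eq_zero
  simp only [PyFT, eval₂_add, eval₂_sub, eval₂_mul, eval₂_pow, eval₂_ofNat, eval₂_X,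
    eval₂_C, RingHom.coe_coe, aeval_X, eval₂_neg]
  -- all monomials have even degree, so `s ^ 2 = 3 / m` can be substituted
  obtain ⟨m, hm⟩ : ∃ m, m = 1 + 3 * r ^ 2 := ⟨_, rfl⟩
  obtain ⟨w, hw⟩ : ∃ w, w = (2 * r + 1 + k * r) / 2 := ⟨_, rfl⟩
  have hs : s ^ 2 * m = 3 := by rw [hm, h.scale]
  have hm0 : m ≠ 0 := by rw [hm]; positivity
  rw [← hw]
  refine mul_left_cancel₀ (pow_ne_zero 4 hm0) ?_
  trans 81 * m ^ 4 - 648 * r ^ 2 * (s ^ 2 * m) * m ^ 3 + 144 * r ^ 4 * (s ^ 2 * m) ^ 2 * m ^ 2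
      - 2304 * r ^ 6 * (s ^ 2 * m) ^ 3 * m + 4096 * r ^ 8 * (s ^ 2 * m) ^ 4
      + 432 * r * w * (s ^ 2 * m) * m ^ 3 - 864 * r ^ 3 * w * (s ^ 2 * m) ^ 2 * m ^ 2
      + 6528 * r ^ 5 * w * (s ^ 2 * m) ^ 3 * m - 10240 * r ^ 7 * w * (s ^ 2 * m) ^ 4
      - 216 * w ^ 2 * (s ^ 2 * m) * m ^ 3 + 1584 * r ^ 2 * w ^ 2 * (s ^ 2 * m) ^ 2 * m ^ 2
      - 5376 * r ^ 4 * w ^ 2 * (s ^ 2 * m) ^ 3 * m + 9216 * r ^ 6 * w ^ 2 * (s ^ 2 * m) ^ 4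
      - 576 * r * w ^ 3 * (s ^ 2 * m) ^ 2 * m ^ 2 + 1536 * r ^ 3 * w ^ 3 * (s ^ 2 * m) ^ 3 * m
      - 4096 * r ^ 5 * w ^ 3 * (s ^ 2 * m) ^ 4 + 144 * w ^ 4 * (s ^ 2 * m) ^ 2 * m ^ 2
      - 384 * r ^ 2 * w ^ 4 * (s ^ 2 * m) ^ 3 * m + 1024 * r ^ 4 * w ^ 4 * (s ^ 2 * m) ^ 4
  · ring
  · rw [hs, hm, hw]
    linear_combination (324 * r ^ 2 - 1296 * r ^ 3 + 324 * r ^ 3 * k + 2187 * r ^ 4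
      - 1296 * r ^ 4 * k + 81 * r ^ 4 * k ^ 2 - 972 * r ^ 5 + 2268 * r ^ 5 * k
      - 324 * r ^ 5 * k ^ 2 + 729 * r ^ 6 + 567 * r ^ 6 * k ^ 2) * h.curve

end IsParameter

end Harborth

theorem mainTheorem3 :
    Nonempty Harborth.Configuration ∧
    (∀ c : Harborth.Configuration,
      Harborth.IsMinimalPolynomial Harborth.PyD c.yD ∧
      Harborth.IsMinimalPolynomial Harborth.PyE c.yE ∧
      Harborth.IsMinimalPolynomial Harborth.PyF c.yF) ∧
    (∀ P ∈ ({Harborth.PyD, Harborth.PyE, Harborth.PyF} : Set (Polynomial ℤ)),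
      P.natDegree = 22 ∧ Harborth.IsEven P ∧ Irreducible P) ∧
    ((Harborth.resultantPT Harborth.PyDT).natDegree = 44 ∧
      Harborth.PyD ∣ Harborth.resultantPT Harborth.PyDT) ∧
    ((Harborth.resultantPT Harborth.PyET).natDegree = 44 ∧
      Harborth.PyE ∣ Harborth.resultantPT Harborth.PyET) ∧
    ((Harborth.resultantPT Harborth.PyFT).natDegree = 88 ∧
      Harborth.PyF ∣ Harborth.resultantPT Harborth.PyFT) := by
  obtain ⟨r, k, s, h, hr, hk⟩ := Harborth.exists_isParameter
  obtain ⟨-, degD, evenD, irrD, dvdD⟩ := h.isMinimalPolynomial_PyD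
  obtain ⟨-, degE, evenE, irrE, dvdE⟩ := h.isMinimalPolynomial_PyE
  obtain ⟨-, degF, evenF, irrF, dvdF⟩ := h.isMinimalPolynomial_PyF
  refine ⟨h.nonempty_configuration hr hk, fun c => ?_, ?_,
    ⟨Harborth.natDegree_resultantPT_PyDT, dvdD _ h.aeval_resultantPT_PyDT⟩,
    ⟨Harborth.natDegree_resultantPT_PyET, dvdE _ h.aeval_resultantPT_PyET⟩,
    ⟨Harborth.natDegree_resultantPT_PyFT, dvdF _ h.aeval_resultantPT_PyFT⟩⟩
  · obtain ⟨r', k', s', h', -, hD, hE, hF⟩ := c.exists_parameters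
    rw [hD, hE, hF]
    exact ⟨h'.isMinimalPolynomial_PyD.1, h'.isMinimalPolynomial_PyE.1,
      h'.isMinimalPolynomial_PyF.1⟩
  · rintro P (rfl | rfl | rfl)
    exacts [⟨degD, evenD, irrD⟩, ⟨degE, evenE, irrE⟩, ⟨degF, evenF, irrF⟩]
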